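/- Let $G=(V,E)$ be a finite simple graph with weights $W:V\to\mathbb{Z}_{\ge 0}$ and let $C\ge 0$ be an integer. For an assignment of colors to the vertices of $G$ (in which adjacent vertices may receive the same color), a monochromatic component is a connected component of the subgraph induced by the vertices of one color. The assignment is feasible if the sum of the weights of the vertices in each monochromatic component is at most $C$. The non-splittable weighted component coloring problem asks for a feasible assignment that uses the minimum number of colors. An interval representation of a proper interval graph $G$ is a family of non-empty closed intervals $(I_v)_{v\in V}$ of the real line, none of which is properly contained in another, such that distinct vertices $u,v$ are adjacent if and only if $I_u\cap I_v\neq\emptyset$. Theorem. There is a $2$-approximation algorithm for the non-splittable weighted component coloring problem on proper interval graphs that are given with an interval representation, and it runs in polynomial time. That is, there are a deterministic algorithm (a program for a random access machine with addition and subtraction) and a polynomial $p$ such that, for every proper interval graph $G$ with an interval representation with integer endpoints, all weights $W$ and every capacity $C$ with $W(v)\le C$ for all $v\in V$, the algorithm, given the endpoints of the intervals, the weights and $C$, halts within time $p(N)$, where $N$ is the number of bits of this input and time is measured by the logarithmic cost criterion, and outputs a number $\lambda$ together with a feasible assignment of colors from $\{1,\dots,\lambda\}$ to the vertices of $G$ such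 that $\lambda\le 2\lambda^*$, where $\lambda^*$ is the minimum number of colors of a feasible assignment. -/

import Mathlib

/-! ### Weighted component colorings -/

section Coloring

variable {V : Type*} [Fintype V] {κ : Type*}

open Classical in
/-- The weight of a chromon. Here `f` is an assignment of colors to the vertices, `c` is a color,
and the chromon `K` is a connected component of the subgraph of `G` induced by the color class
of `c`. -/
noncomputable def chromonWeight (G : SimpleGraph V) (w : V → ℕ) (f : V → κ) (c : κ)
    (K : (G.induce {v | f v = c}).ConnectedComponent) : ℕ :=
  ∑ v ∈ Finset.univ.filter (fun v : {v | f v = c} => v ∈ K.supp), w v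

/-- `f` is a (non-splittable) `C`-component coloring assignment of the weighted graph `(G, w)`:
every monochromatic component has total weight at most `C`. Adjacent vertices may have the
same color. -/
def IsComponentColoring (G : SimpleGraph V) (w : V → ℕ) (C : ℕ) (f : V → κ) : Prop :=
  ∀ (c : κ) (K : (G.induce {v | f v = c}).ConnectedComponent), chromonWeight G w f c K ≤ C

/-- The weighted graph `(G, w)` is `[lam, C]`-colorable. -/
def IsComponentColorable (G : SimpleGraph V) (w : V → ℕ) (lam C : ℕ) : Prop :=
  ∃ f : V → Fin lam, IsComponentColoring G w C f

end Coloring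

/-! ### Proper interval representations -/

/-- The closed intervals `[l v, r v]` of the real line form an interval representation of `G` in
which no interval properly contains another one, that is, they witness that `G` is a proper
interval graph. The endpoints are integers, so that they can be given to a machine. -/
structure IsProperIntervalRep {V : Type*} (G : SimpleGraph V) (l r : V → ℤ) : Prop where
  nonempty : ∀ v, (Set.Icc (l v : ℝ) (r v : ℝ)).Nonempty
  adj_iff : ∀ u v, u ≠ v →
    (G.Adj u v ↔ (Set.Icc (l u : ℝ) (r u : ℝ) ∩ Set.Icc (l v : ℝ) (r v : ℝ)).Nonempty)
  proper : ∀ u v, ¬ Set.Icc (l u : ℝ) (r u : ℝ) ⊂ Set.Icc (l v : ℝ) (r v : ℝ)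

/-! ### A random access machine with logarithmic cost -/

namespace RAM

/-- The memory: one integer in each cell; cells are indexed by the integers. -/
abbrev Mem : Type := ℤ → ℤ

/-- The number of bits needed for writing down an integer, with its sign. -/
def bits (z : ℤ) : ℕ := Nat.size z.natAbs + 1

/-- Programs of the machine. The only arithmetic operations are addition and subtraction;
`load` and `store` are the instructions with indirect addressing. -/
inductive Program : Type
  /-- `M[d] := k` -/
  | const (d k : ℤ) : Program
  /-- `M[d] := M[a] + M[b]` -/
  | add (d a b : ℤ) : Program
  /-- `M[d] := M[a] - M[b]` -/
  | sub (d a b : ℤ) : Program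
  /-- `M[d] := M[M[a]]` -/
  | load (d a : ℤ) : Program
  /-- `M[M[a]] := M[b]` -/
  | store (a b : ℤ) : Program
  /-- first `P`, then `Q` -/
  | seq (P Q : Program) : Program
  /-- if `M[a] > 0` then `P` else `Q` -/
  | ifPos (a : ℤ) (P Q : Program) : Program
  /-- while `M[a] > 0` do `P` -/
  | whilePos (a : ℤ) (P : Program) : Program

/-- `Exec P M M' t`: started in memory `M`, the program `P` halts in memory `M'` after time `t`.
Each instruction and each test is charged the number of bits of all the addresses and cell
contents that it handles (the logarithmic cost criterion). -/
inductive Exec : Program → Mem → Mem → ℕ → Prop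
  | const (d k : ℤ) (M : Mem) :
      Exec (.const d k) M (Function.update M d k) (bits d + bits k)
  | add (d a b : ℤ) (M : Mem) :
      Exec (.add d a b) M (Function.update M d (M a + M b))
        (bits d + bits a + bits b + bits (M a) + bits (M b) + bits (M a + M b))
  | sub (d a b : ℤ) (M : Mem) :
      Exec (.sub d a b) M (Function.update M d (M a - M b))
        (bits d + bits a + bits b + bits (M a) + bits (M b) + bits (M a - M b))
  | load (d a : ℤ) (M : Mem) :
      Exec (.load d a) M (Function.update M d (M (M a)))
        (bits d + bits a + bits (M a) + bits (M (M a)))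
  | store (a b : ℤ) (M : Mem) :
      Exec (.store a b) M (Function.update M (M a) (M b))
        (bits a + bits b + bits (M a) + bits (M b))
  | seq {P Q : Program} {M M₁ M₂ : Mem} {s t : ℕ} :
      Exec P M M₁ s → Exec Q M₁ M₂ t → Exec (.seq P Q) M M₂ (s + t)
  | ifTrue {a : ℤ} {P Q : Program} {M M₁ : Mem} {t : ℕ} :
      0 < M a → Exec P M M₁ t → Exec (.ifPos a P Q) M M₁ (bits a + bits (M a) + t)
  | ifFalse {a : ℤ} {P Q : Program} {M M₁ : Mem} {t : ℕ} :
      M a ≤ 0 → Exec Q M M₁ t → Exec (.ifPos a P Q) M M₁ (bits a + bits (M a) + t)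
  | whileTrue {a : ℤ} {P : Program} {M M₁ M₂ : Mem} {s t : ℕ} :
      0 < M a → Exec P M M₁ s → Exec (.whilePos a P) M₁ M₂ t →
      Exec (.whilePos a P) M M₂ (bits a + bits (M a) + s + t)
  | whileFalse {a : ℤ} {P : Program} {M : Mem} :
      M a ≤ 0 → Exec (.whilePos a P) M M (bits a + bits (M a))

/-- The machine is deterministic: result and running time are determined by the program and the
initial memory. -/
theorem Exec.deterministic {P : Program} {M M₁ M₂ : Mem} {t₁ t₂ : ℕ}
    (h₁ : Exec P M M₁ t₁) (h₂ : Exec P M M₂ t₂) : M₁ = M₂ ∧ t₁ = t₂ := by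
  induction h₁ generalizing M₂ t₂ with
  | const | add | sub | load | store => cases h₂; exact ⟨rfl, rfl⟩
  | seq _ _ ih ih' =>
    cases h₂ with
    | seq g g' =>
      obtain ⟨rfl, rfl⟩ := ih g
      obtain ⟨rfl, rfl⟩ := ih' g'
      exact ⟨rfl, rfl⟩
  | ifTrue h _ ih =>
    cases h₂ with
    | ifTrue _ g => obtain ⟨rfl, rfl⟩ := ih g; exact ⟨rfl, rfl⟩
    | ifFalse h' _ => omega
  | ifFalse h _ ih =>
    cases h₂ with
    | ifTrue h' _ => omega
    | ifFalse _ g => obtain ⟨rfl, rfl⟩ := ih g; exact ⟨rfl, rfl⟩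
  | whileTrue h _ _ ih ih' =>
    cases h₂ with
    | whileTrue _ g g' =>
      obtain ⟨rfl, rfl⟩ := ih g
      obtain ⟨rfl, rfl⟩ := ih' g'
      exact ⟨rfl, rfl⟩
    | whileFalse h' => omega
  | whileFalse h =>
    cases h₂ with
    | whileTrue h' _ _ => omega
    | whileFalse _ => exact ⟨rfl, rfl⟩

/-- The initial memory for the input `xs`: the list is in the cells `0, 1, 2, …`, and all other
cells hold `0`. -/
def initMem (xs : List ℤ) : Mem := fun a => if 0 ≤ a then xs.getD a.toNat 0 else 0

/-- The length of the input `xs` in bits. -/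
def inputSize (xs : List ℤ) : ℕ := (xs.map bits).sum

end RAM

/-! ### Instances and solutions as seen by the machine -/

/-- The input: the number of vertices, the capacity, the left endpoints, the right endpoints and
the weights. -/
def encodeInstance {n : ℕ} (l r : Fin n → ℤ) (w : Fin n → ℕ) (C : ℕ) : List ℤ :=
  [(n : ℤ), (C : ℤ)] ++ List.ofFn l ++ List.ofFn r ++ List.ofFn (fun v => (w v : ℤ))

/-- The memory `M` displays the assignment `f` with the colors `1, …, lam`: the number `lam` is in
cell `0` and the color of the vertex with index `v` is in cell `v + 1`. -/
def DisplaysAssignment {n lam : ℕ} (M : RAM.Mem) (f : Fin n → Fin lam) : Prop :=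
  M 0 = (lam : ℤ) ∧ ∀ v : Fin n, M ((v : ℤ) + 1) = (((f v : ℕ) + 1 : ℕ) : ℤ)

/-! Take the vertices by increasing left endpoint and fill blocks of weight at most `C` by next fit:
a new block is opened exactly when the next vertex does not fit into the last block. Let `lam` be
the least number such that the block indices of any two meeting intervals differ by less than `lam`,
and color the blocks cyclically with `lam` colors. Adjacent vertices of equal color have block
indices that are congruent modulo `lam` and differ by less than `lam`, so they share a block. Each
monochromatic component therefore lies inside one block and weighs at most `C`.

For the ratio, suppose that the intervals of `u` and `v` meet and that their blocks differ by `D >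
0`. No interval properly contains another, so all vertices with left endpoints between those of `u`
and `v` form a clique. A block together with the vertex that opens the next one weighs more than
`C`. From the blocks after that of `u` up to that of `v`, this yields `D / 2` disjoint groups inside
the clique, each of weight at least `C + 1`. A feasible coloring with `μ` colors gives every clique
weight at most `μ * C`, since clique members of one color lie in one component. Hence `D / 2 < μ`
and `D + 1 ≤ 2 * μ`. These two halves are `IsNextFit.isComponentColoring` and `IsNextFit.span_le`.

For the running time it suffices to count steps (`RAM.Reaches`). Only addition and subtraction are
available, so one step lengthens the longest number by at most one bit; `s` steps from numbers of
`k` bits cost at most `6 * s * (k + s)`. The program makes `O(n ^ 2)` steps. -/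

/-! ### Cliques in component colorings -/

section Clique

variable {V : Type*} [Fintype V] {G : SimpleGraph V} {w : V → ℕ} {C : ℕ}

open Classical in
/-- The members of a clique that have the same color lie in one monochromatic component. -/
theorem IsComponentColoring.sum_clique_color_le {κ : Type*} {f : V → κ}
    (hf : IsComponentColoring G w C f) {Q : Finset V} (hQ : G.IsClique (Q : Set V)) (c : κ) :
    ∑ v ∈ Q with f v = c, w v ≤ C := by
  by_cases hne : (Q.filter (fun v => f v = c)).Nonempty
  · obtain ⟨x, hx⟩ := hne
    rw [Finset.mem_filter] at hx
    let H := G.induce {v | f v = c}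
    let x' : {v | f v = c} := ⟨x, hx.2⟩
    refine le_trans ?_ (hf c (H.connectedComponentMk x'))
    unfold chromonWeight
    refine le_trans ?_
      (Finset.sum_map (Finset.univ.filter _) (Function.Embedding.subtype _) w).le
    refine Finset.sum_le_sum_of_subset fun y hy => ?_
    rw [Finset.mem_filter] at hy
    rw [Finset.mem_map]
    refine ⟨⟨y, hy.2⟩, ?_, rfl⟩
    rw [Finset.mem_filter, SimpleGraph.ConnectedComponent.mem_supp_iff,
      SimpleGraph.ConnectedComponent.eq]
    refine ⟨Finset.mem_univ _, ?_⟩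
    by_cases hxy : y = x
    · subst hxy; exact SimpleGraph.Reachable.refl _
    · exact SimpleGraph.Adj.reachable (G := H)
        (by simpa [H] using hQ (by simpa using hy.1) (by simpa using hx.1) hxy)
  · rw [Finset.not_nonempty_iff_eq_empty] at hne
    simp [hne]

-- Each of the `μ` color classes contributes at most `C`. This is the only lower bound on the
-- optimum that the approximation ratio uses.
open Classical in
theorem IsComponentColorable.sum_clique_le {μ : ℕ} (h : IsComponentColorable G w μ C)
    {Q : Finset V} (hQ : G.IsClique (Q : Set V)) : ∑ v ∈ Q, w v ≤ μ * C := by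
  obtain ⟨f, hf⟩ := h
  rw [← Finset.sum_fiberwise_of_maps_to (t := Finset.univ) (g := f) (fun _ _ => Finset.mem_univ _)]
  have h : ∀ c ∈ Finset.univ, ∑ v ∈ Q with f v = c, w v ≤ C := fun c _ => by
    convert hf.sum_clique_color_le hQ c
  refine (Finset.sum_le_sum h).trans ?_
  simp

open Classical in
/-- If the blocks `b v = i` have weight at most `C` and adjacent vertices of the same color lie in
the same block, then the coloring is feasible. -/
theorem isComponentColoring_of_blocks {κ : Type*} {f : V → κ} {b : V → ℕ}
    (hb : ∀ x, ∑ v with b v = b x, w v ≤ C)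
    (hadj : ∀ u v, G.Adj u v → f u = f v → b u = b v) : IsComponentColoring G w C f := by
  intro c K
  induction K using SimpleGraph.ConnectedComponent.ind with | _ x
  refine le_trans ?_ ((hb x).trans' (le_of_eq (by congr)))
  unfold chromonWeight
  refine (Finset.sum_map (Finset.univ.filter _) (Function.Embedding.subtype _) w).ge.trans ?_
  refine Finset.sum_le_sum_of_subset fun y hy => ?_
  obtain ⟨z, hz, rfl⟩ := Finset.mem_map.1 hy
  rw [Finset.mem_filter] at hz
  have hr := SimpleGraph.ConnectedComponent.exact
    (SimpleGraph.ConnectedComponent.mem_supp_iff _ _ |>.1 hz.2)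
  rw [Finset.mem_filter]
  refine ⟨Finset.mem_univ _, ?_⟩
  obtain ⟨p⟩ := hr
  change b z.1 = b x.1
  clear hz hy
  -- The block stays the same along every edge of a walk inside the color class.
  induction p with
  | nil => rfl
  | @cons u v t h p ih =>
    rw [← ih]
    exact hadj _ _ (by simpa using h) (u.2.trans v.2.symm)

end Clique

/-! ### Cliques in proper interval representations. -/

section Interval

variable {V : Type*} {G : SimpleGraph V} {l r : V → ℤ}

theorem IsProperIntervalRep.left_le_right (h : IsProperIntervalRep G l r) (v : V) : l v ≤ r v := by
  have := h.nonempty v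
  rw [Set.nonempty_Icc] at this
  exact_mod_cast this

theorem IsProperIntervalRep.adj_iff_le (h : IsProperIntervalRep G l r) {u v : V} (huv : u ≠ v) :
    G.Adj u v ↔ l u ≤ r v ∧ l v ≤ r u := by
  rw [h.adj_iff u v huv, Set.Icc_inter_Icc, Set.nonempty_Icc]
  have hu := h.left_le_right u
  have hv := h.left_le_right v
  norm_cast
  simp only [sup_le_iff, le_inf_iff]
  tauto

theorem IsProperIntervalRep.right_mono (h : IsProperIntervalRep G l r) {u v : V}
    (huv : l u ≤ l v) : r u ≤ r v := by
  by_contra hlt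
  rw [not_le] at hlt
  refine h.proper v u ⟨Set.Icc_subset_Icc (by exact_mod_cast huv) (by exact_mod_cast hlt.le), ?_⟩
  intro hs
  have h1 : (r u : ℝ) ∈ Set.Icc (l u : ℝ) (r u : ℝ) :=
    ⟨by exact_mod_cast h.left_le_right u, le_rfl⟩
  have h2 := (hs h1).2
  norm_cast at h2
  omega

/-- If two intervals meet, then all vertices whose left endpoints lie between theirs form a
clique. -/
theorem IsProperIntervalRep.isClique_between (h : IsProperIntervalRep G l r) {u v : V}
    (huv : l v ≤ r u) : G.IsClique {x | l u ≤ l x ∧ l x ≤ l v} := by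
  rintro x ⟨hx1, hx2⟩ y ⟨hy1, hy2⟩ hxy
  -- Right endpoints are ordered like left ones, so `l x ≤ l v ≤ r u ≤ r y`, and likewise with `x`
  -- and `y` exchanged.
  have h1 := h.right_mono hx1
  have h2 := h.right_mono hy1
  exact (h.adj_iff_le hxy).2 ⟨by omega, by omega⟩

end Interval

/-! ### Next-fit blocks in the order of the left endpoints -/

section Greedy

variable {V : Type*} [Fintype V]

/-- The blocks built so far: `b v = 0` if `v` has not been placed, and otherwise `b v` is the index
of the block of `v`. The last block is `blk`, and its weight is `sum`; before any block is opened,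
`sum` exceeds the capacity. Vertices are placed by increasing `l`, and a new block is opened
only by a vertex that does not fit into the last one. -/
structure IsNextFit (l : V → ℤ) (w : V → ℕ) (C : ℕ) (b : V → ℕ) (blk sum : ℕ) : Prop where
  placed_le : ∀ u v, 0 < b u → b v = 0 → l u ≤ l v
  mono : ∀ u v, 0 < b u → 0 < b v → l u < l v → b u ≤ b v
  le_blk : ∀ v, b v ≤ blk
  lt_sum : blk = 0 → C < sum
  sum_eq : 0 < blk → sum = ∑ v with b v = blk, w v
  weight_le : ∀ i, 0 < i → ∑ v with b v = i, w v ≤ C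
  opens : ∀ i, 0 < i → i < blk → ∃ x, b x = i + 1 ∧ (∀ y, b y = i + 1 → l x ≤ l y) ∧
    C < (∑ v with b v = i, w v) + w x

variable {l : V → ℤ} {w : V → ℕ} {C : ℕ} {b : V → ℕ} {blk sum : ℕ}

theorem IsNextFit.init (l : V → ℤ) (w : V → ℕ) (C : ℕ) :
    IsNextFit l w C (fun _ => 0) 0 (C + 1) where
  placed_le := by simp
  mono := by simp
  le_blk := by simp
  lt_sum := by simp
  sum_eq := by simp
  weight_le := fun i hi => by simp [hi.ne]
  opens := by simp

theorem sum_block_update [DecidableEq V] {x : V} (hx : b x = 0) {i : ℕ} (hi : 0 < i) :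
    ∑ v with Function.update b x i v = i, w v = (∑ v with b v = i, w v) + w x := by
  have : Finset.univ.filter (fun v => Function.update b x i v = i) =
      insert x (Finset.univ.filter (fun v => b v = i)) := by
    ext v
    by_cases hv : v = x <;> simp [hv]
  rw [this, Finset.sum_insert (by simp [hx, hi.ne]), add_comm]

theorem sum_block_update_of_ne [DecidableEq V] {x : V} (hx : b x = 0) {i j : ℕ} (hj : 0 < j)
    (hij : j ≠ i) :
    ∑ v with Function.update b x i v = j, w v = ∑ v with b v = j, w v := by
  congr 1
  ext v
  by_cases hv : v = x
  · subst hv; simp [hx, hj.ne, hij.symm]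
  · simp [hv]

/-- Only the last block changes, and `opens` speaks of the weights of earlier blocks only. The new
vertex cannot precede the opener of the last block, because placed vertices have the smallest left
endpoints. -/
theorem IsNextFit.add_to_last [DecidableEq V] (h : IsNextFit l w C b blk sum) {x : V}
    (hx : b x = 0) (hmin : ∀ v, b v = 0 → l x ≤ l v) (hfit : sum + w x ≤ C) :
    IsNextFit l w C (Function.update b x blk) blk (sum + w x) := by
  -- As long as there is no block, `sum` exceeds `C` and nothing fits.
  have hblk : 0 < blk := by
    by_contra h0
    have := h.lt_sum (by omega)
    omega
  refine ⟨?_, ?_, ?_, by omega, ?_, ?_, ?_⟩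
  · intro u v hu hv
    have hvx : v ≠ x := by rintro rfl; simp at hv; omega
    rw [Function.update_of_ne hvx] at hv
    by_cases hux : u = x
    · subst hux; exact hmin v hv
    · rw [Function.update_of_ne hux] at hu; exact h.placed_le u v hu hv
  · intro u v hu hv huv
    by_cases hvx : v = x
    · subst hvx
      have hux : u ≠ v := by rintro rfl; omega
      simpa [hux] using h.le_blk u
    · rw [Function.update_of_ne hvx] at hv ⊢
      by_cases hux : u = x
      · subst hux; have := h.placed_le v u hv hx; omega
      · rw [Function.update_of_ne hux] at hu ⊢; exact h.mono u v hu hv huv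
  · intro v
    by_cases hvx : v = x
    · simp [hvx]
    · simpa [hvx] using h.le_blk v
  · intro _
    rw [sum_block_update hx hblk, h.sum_eq hblk]
  · intro i hi
    by_cases hib : i = blk
    · subst hib; rw [sum_block_update hx hblk, ← h.sum_eq hblk]; exact hfit
    · rw [sum_block_update_of_ne hx hi hib]; exact h.weight_le i hi
  · intro i hi hib
    obtain ⟨y, hy1, hy2, hy3⟩ := h.opens i hi hib
    have hyx : y ≠ x := by rintro rfl; omega
    refine ⟨y, by rwa [Function.update_of_ne hyx], ?_, ?_⟩
    · intro z hz
      by_cases hzx : z = x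
      · subst hzx; exact h.placed_le _ _ (by omega) hx
      · rw [Function.update_of_ne hzx] at hz; exact hy2 z hz
    · rwa [sum_block_update_of_ne hx hi hib.ne]

/-- The former last block becomes closed, and `x` is the witness for it in `opens`: it did not fit
there, and it is the only member of its own block. -/
theorem IsNextFit.open_new [DecidableEq V] (h : IsNextFit l w C b blk sum) {x : V}
    (hx : b x = 0) (hmin : ∀ v, b v = 0 → l x ≤ l v) (hfit : C < sum + w x) (hw : w x ≤ C) :
    IsNextFit l w C (Function.update b x (blk + 1)) (blk + 1) (w x) := by
  have hempty : ∑ v with b v = blk + 1, w v = 0 := by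
    rw [Finset.filter_eq_empty_iff.2, Finset.sum_empty]
    intro v _ hv
    have := h.le_blk v
    omega
  refine ⟨?_, ?_, ?_, by omega, ?_, ?_, ?_⟩
  · intro u v hu hv
    have hvx : v ≠ x := by rintro rfl; simp at hv
    rw [Function.update_of_ne hvx] at hv
    by_cases hux : u = x
    · subst hux; exact hmin v hv
    · rw [Function.update_of_ne hux] at hu; exact h.placed_le u v hu hv
  · intro u v hu hv huv
    by_cases hvx : v = x
    · subst hvx
      have hux : u ≠ v := by rintro rfl; omega
      have := h.le_blk u
      simp [hux]
      omega
    · rw [Function.update_of_ne hvx] at hv ⊢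
      by_cases hux : u = x
      · subst hux; have := h.placed_le v u hv hx; omega
      · rw [Function.update_of_ne hux] at hu ⊢; exact h.mono u v hu hv huv
  · intro v
    by_cases hvx : v = x
    · simp [hvx]
    · have := h.le_blk v
      simp [hvx]
      omega
  · intro _
    rw [sum_block_update hx (by omega), hempty, zero_add]
  · intro i hi
    by_cases hib : i = blk + 1
    · subst hib; rw [sum_block_update hx (by omega), hempty, zero_add]; exact hw
    · rw [sum_block_update_of_ne hx hi hib]; exact h.weight_le i hi
  · intro i hi hib
    rw [sum_block_update_of_ne hx hi hib.ne]
    by_cases hlast : i = blk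
    · subst hlast
      refine ⟨x, by simp, ?_, by rw [← h.sum_eq hi]; exact hfit⟩
      intro z hz
      by_cases hzx : z = x
      · rw [hzx]
      · rw [Function.update_of_ne hzx] at hz
        have := h.le_blk z
        omega
    · obtain ⟨y, hy1, hy2, hy3⟩ := h.opens i hi (by omega)
      have hyx : y ≠ x := by rintro rfl; omega
      refine ⟨y, by rwa [Function.update_of_ne hyx], ?_, hy3⟩
      intro z hz
      by_cases hzx : z = x
      · subst hzx; exact h.placed_le _ _ (by omega) hx
      · rw [Function.update_of_ne hzx] at hz; exact hy2 z hz

/-- A clique that meets two blocks whose indices differ by `D` forces `D + 1 ≤ 2 * μ`. -/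
theorem IsNextFit.span_le {G : SimpleGraph V} {r : V → ℤ} (h : IsNextFit l w C b blk sum)
    (hG : IsProperIntervalRep G l r) (hpos : ∀ v, 0 < b v) {μ : ℕ}
    (hμ : IsComponentColorable G w μ C) {u v : V} (huv : l v ≤ r u) :
    b v + 1 ≤ b u + 2 * μ := by
  classical
  have hμ0 : 0 < μ := by
    obtain ⟨f, -⟩ := hμ
    exact (Nat.zero_le _).trans_lt (f u).2
  -- The hypothesis `huv` is only half of the condition for meeting, so `v` may also lie entirely to
  -- the left of `u`. Here `1 ≤ μ` is enough.
  by_cases hlt : b v ≤ b u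
  · omega
  obtain ⟨D, hD⟩ : ∃ D, b v = b u + D := ⟨b v - b u, by omega⟩
  set m := D / 2 with hm
  let Q : Finset V := Finset.univ.filter fun x => l u ≤ l x ∧ l x ≤ l v
  have hQ := hμ.sum_clique_le (Q := Q) (by simpa [Q] using hG.isClique_between huv)
  have hu := hpos u
  -- Group `j` consists of block `b u + 2 * j + 1` and the opener of the next block. Since `2 * j +
  -- 2 ≤ D`, no group goes beyond the block of `v`.
  have key : ∀ j : Fin m, ∃ x, b x = b u + 2 * j + 2 ∧ (∀ y, b y = b u + 2 * j + 2 → l x ≤ l y) ∧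
      C < (∑ v with b v = b u + 2 * j + 1, w v) + w x := fun j =>
    h.opens (b u + 2 * j + 1) (by omega) (by have := h.le_blk v; omega)
  choose x hx1 hx2 hx3 using key
  let S : Fin m → Finset V := fun j =>
    insert (x j) (Finset.univ.filter fun v => b v = b u + 2 * j + 1)
  have hS : ∀ j, C + 1 ≤ ∑ v ∈ S j, w v := by
    intro j
    rw [Finset.sum_insert (by simp [hx1])]
    have := hx3 j
    omega
  have hbS : ∀ j, ∀ y ∈ S j, b y = b u + 2 * j + 1 ∨ b y = b u + 2 * j + 2 := by
    intro j y hy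
    rcases Finset.mem_insert.1 hy with rfl | hy
    · exact Or.inr (hx1 j)
    · exact Or.inl (Finset.mem_filter.1 hy).2
  have hdisj : Set.PairwiseDisjoint (Set.univ : Set (Fin m)) S := by
    intro i _ j _ hij
    refine Finset.disjoint_left.2 fun y hyi hyj => hij (Fin.ext ?_)
    have h1 := hbS i y hyi
    have h2 := hbS j y hyj
    omega
  -- A later block than that of `u` forces a left endpoint not before `l u`. On the other side, a
  -- group reaches the block of `v` only with its opener, which has the least left endpoint there,
  -- so at most `l v`.
  have hsub : Finset.univ.biUnion S ⊆ Q := by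
    intro y hy
    obtain ⟨j, -, hy⟩ := Finset.mem_biUnion.1 hy
    have hby := hbS j y hy
    refine Finset.mem_filter.2 ⟨Finset.mem_univ _, ?_, ?_⟩
    · by_contra hc
      have := h.mono y u (hpos y) (hpos u) (by omega)
      omega
    · by_contra hc
      have hbv := h.mono v y (hpos v) (hpos y) (by omega)
      rcases Finset.mem_insert.1 hy with rfl | hy'
      · have := hx2 j v (by have := hx1 j; omega)
        omega
      · have := (Finset.mem_filter.1 hy').2
        omega
  have hsum : m * (C + 1) ≤ μ * C := by
    refine le_trans ?_ ((Finset.sum_le_sum_of_subset hsub).trans hQ)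
    rw [Finset.sum_biUnion (by simpa using hdisj)]
    simpa using Finset.sum_le_sum (fun j (_ : j ∈ Finset.univ) => hS j)
  -- If `μ ≤ m`, then `m * C + m ≤ μ * C ≤ m * C` forces `m = 0`, against `0 < μ`.
  have hmμ : m < μ := by
    by_contra hc
    have h1 : μ * C ≤ m * C := Nat.mul_le_mul_right _ (by omega)
    have h2 : m * (C + 1) = m * C + m := by ring
    omega
  omega

/-- Coloring the blocks cyclically is feasible if no two adjacent vertices lie in blocks whose
indices differ by the number of colors or more. -/
theorem IsNextFit.isComponentColoring {G : SimpleGraph V} {lam : ℕ}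
    (h : IsNextFit l w C b blk sum) (hpos : ∀ v, 0 < b v)
    (hspan : ∀ u v, G.Adj u v → b v < b u + lam) {f : V → Fin lam}
    (hf : ∀ v, (f v : ℕ) = (b v - 1) % lam) : IsComponentColoring G w C f := by
  have key : ∀ u v, G.Adj u v → f u = f v → b u ≤ b v → b u = b v := by
    intro u v huv hfuv hle
    have h1 : (b u - 1) ≡ (b v - 1) [MOD lam] := by
      rw [Nat.ModEq, ← hf, ← hf, hfuv]
    have h2 := hspan u v huv
    have h3 := hpos u
    have h4 := (Nat.modEq_iff_dvd' (by omega)).1 h1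
    have h5 := Nat.eq_zero_of_dvd_of_lt h4 (by omega)
    omega
  refine isComponentColoring_of_blocks (b := b) (fun x => h.weight_le _ (hpos x)) ?_
  intro u v huv hfuv
  rcases le_total (b u) (b v) with hle | hle
  · exact key u v huv hfuv hle
  · exact (key v u huv.symm hfuv.symm hle).symm

end Greedy

/-! ### Reasoning about the machine by counting steps -/

namespace RAM

theorem bits_le_iff {z : ℤ} {k : ℕ} : bits z ≤ k + 1 ↔ z.natAbs < 2 ^ k := by
  rw [bits, Nat.add_le_add_iff_right, Nat.size_le]

theorem one_le_bits (z : ℤ) : 1 ≤ bits z := Nat.le_add_left _ _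

/-- A sum or difference of two numbers is at most twice the larger one in absolute value, which
costs one more bit. -/
theorem bits_of_natAbs_le {a b c : ℤ} {k : ℕ} (ha : bits a ≤ k) (hb : bits b ≤ k)
    (hc : c.natAbs ≤ a.natAbs + b.natAbs) : bits c ≤ k + 1 := by
  obtain _ | k := k
  · have := one_le_bits a
    omega
  rw [bits_le_iff] at *
  rw [pow_succ]
  omega

/-- The largest number of bits of an address or a constant in the text of a program. -/
def Program.width : Program → ℕ
  | .const d k => max (bits d) (bits k)
  | .add d a b | .sub d a b => max (bits d) (max (bits a) (bits b))
  | .load d a => max (bits d) (bits a)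
  | .store a b => max (bits a) (bits b)
  | .seq P Q => max P.width Q.width
  | .ifPos a P Q => max (bits a) (max P.width Q.width)
  | .whilePos a P => max (bits a) P.width

/-- Started in `M`, the program `P` halts after at most `s` instructions and tests in a memory
with the property `Q`. Since a step adds at most one bit to the largest number in the memory, this
bounds the running time. -/
def Reaches (P : Program) (M : Mem) (s : ℕ) (Q : Mem → Prop) : Prop :=
  ∃ M' t, Exec P M M' t ∧ Q M' ∧ ∀ k, P.width ≤ k → (∀ a, bits (M a) ≤ k) →
    (∀ a, bits (M' a) ≤ k + s) ∧ t ≤ 6 * s * (k + s)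

variable {P P' : Program} {M : Mem} {s s' t : ℕ} {Q Q' : Mem → Prop} {a b d k : ℤ}

theorem Reaches.mono (h : Reaches P M s Q) (hs : s ≤ s') (hQ : ∀ M', Q M' → Q' M') :
    Reaches P M s' Q' := by
  obtain ⟨M', t, he, hq, hb⟩ := h
  refine ⟨M', t, he, hQ _ hq, fun k hk hM => ?_⟩
  obtain ⟨h1, h2⟩ := hb k hk hM
  refine ⟨fun a => (h1 a).trans (by omega), h2.trans ?_⟩
  gcongr

theorem bits_update_le {v : ℤ} {k : ℕ} (hM : ∀ a, bits (M a) ≤ k) (hv : bits v ≤ k + 1) (d a : ℤ) :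
    bits (Function.update M d v a) ≤ k + 1 := by
  by_cases h : a = d
  · subst h; simpa
  · rw [Function.update_of_ne h]; exact (hM a).trans (by omega)

/-- Steps that are left over do no harm. -/
theorem reaches_of_one (h : Reaches P M 1 Q) : Reaches P M (s + 1) Q :=
  h.mono (by omega) fun _ h => h

theorem reaches_const (h : Q (Function.update M d k)) : Reaches (.const d k) M (s + 1) Q := by
  refine reaches_of_one ⟨_, _, Exec.const d k M, h, fun j hj hM => ?_⟩
  simp only [Program.width, max_le_iff] at hj
  exact ⟨bits_update_le hM (by omega) d, by omega⟩

theorem reaches_add (v : ℤ) (hv : M a + M b = v) (h : Q (Function.update M d v)) :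
    Reaches (.add d a b) M (s + 1) Q := by
  subst hv
  refine reaches_of_one ⟨_, _, Exec.add d a b M, h, fun j hj hM => ?_⟩
  simp only [Program.width, max_le_iff] at hj
  have h1 := hM a
  have h2 := hM b
  have h3 : bits (M a + M b) ≤ j + 1 := bits_of_natAbs_le h1 h2 (by omega)
  exact ⟨bits_update_le hM h3 d, by omega⟩

theorem reaches_sub (v : ℤ) (hv : M a - M b = v) (h : Q (Function.update M d v)) :
    Reaches (.sub d a b) M (s + 1) Q := by
  subst hv
  refine reaches_of_one ⟨_, _, Exec.sub d a b M, h, fun j hj hM => ?_⟩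
  simp only [Program.width, max_le_iff] at hj
  have h1 := hM a
  have h2 := hM b
  have h3 : bits (M a - M b) ≤ j + 1 := bits_of_natAbs_le h1 h2 (by omega)
  exact ⟨bits_update_le hM h3 d, by omega⟩

theorem reaches_load (v : ℤ) (hv : M (M a) = v) (h : Q (Function.update M d v)) :
    Reaches (.load d a) M (s + 1) Q := by
  subst hv
  refine reaches_of_one ⟨_, _, Exec.load d a M, h, fun j hj hM => ?_⟩
  simp only [Program.width, max_le_iff] at hj
  have h1 := hM a
  have h2 := hM (M a)
  exact ⟨bits_update_le hM (by omega) d, by omega⟩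

theorem reaches_store (v : ℤ) (hd : M a = d) (hv : M b = v) (h : Q (Function.update M d v)) :
    Reaches (.store a b) M (s + 1) Q := by
  subst hd hv
  refine reaches_of_one ⟨_, _, Exec.store a b M, h, fun j hj hM => ?_⟩
  simp only [Program.width, max_le_iff] at hj
  have h1 := hM a
  have h2 := hM b
  exact ⟨bits_update_le hM (by omega) _, by omega⟩

/-- The bound in `Reaches` holds for every admissible `k`, so the second program can be charged with
`k + s`, the length that the first one may have left behind. -/
theorem reaches_seq (h : Reaches P M s fun M' => Reaches P' M' t Q) :
    Reaches (.seq P P') M (s + t) Q := by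
  obtain ⟨M₁, t₁, he₁, ⟨M₂, t₂, he₂, hq, hb₂⟩, hb₁⟩ := h
  refine ⟨M₂, _, Exec.seq he₁ he₂, hq, fun k hk hM => ?_⟩
  simp only [Program.width, max_le_iff] at hk
  obtain ⟨h1, h2⟩ := hb₁ k hk.1 hM
  obtain ⟨h3, h4⟩ := hb₂ (k + s) (by omega) h1
  refine ⟨fun a => (h3 a).trans (by omega), ?_⟩
  calc t₁ + t₂ ≤ 6 * s * (k + s) + 6 * t * (k + s + t) := by omega
    _ ≤ 6 * s * (k + (s + t)) + 6 * t * (k + (s + t)) := by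
        rw [add_assoc k s t]
        gcongr
        omega
    _ = _ := by ring

theorem reaches_ifPos (h₁ : 0 < M a → Reaches P M s Q) (h₂ : M a ≤ 0 → Reaches P' M s Q) :
    Reaches (.ifPos a P P') M (s + 1) Q := by
  have bound : ∀ j t : ℕ, bits a ≤ j → bits (M a) ≤ j → t ≤ 6 * s * (j + s) →
      bits a + bits (M a) + t ≤ 6 * (s + 1) * (j + (s + 1)) := by
    intro j t h1 h2 h3
    calc bits a + bits (M a) + t ≤ 6 * j + 6 * s * (j + s) := by omega
      _ ≤ 6 * (j + (s + 1)) + 6 * s * (j + (s + 1)) := by gcongr <;> omega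
      _ = _ := by ring
  rcases lt_or_ge 0 (M a) with h | h
  · obtain ⟨M', t, he, hq, hb⟩ := h₁ h
    refine ⟨M', _, Exec.ifTrue h he, hq, fun j hj hM => ?_⟩
    simp only [Program.width, max_le_iff] at hj
    obtain ⟨h3, h4⟩ := hb j hj.2.1 hM
    exact ⟨fun a => (h3 a).trans (by omega), bound j t hj.1 (hM a) h4⟩
  · obtain ⟨M', t, he, hq, hb⟩ := h₂ h
    refine ⟨M', _, Exec.ifFalse h he, hq, fun j hj hM => ?_⟩
    simp only [Program.width, max_le_iff] at hj
    obtain ⟨h3, h4⟩ := hb j hj.2.2 hM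
    exact ⟨fun a => (h3 a).trans (by omega), bound j t hj.1 (hM a) h4⟩

/-- The rule for loops: `Inv j` is an invariant that leaves at most `j` rounds. -/
theorem reaches_whilePos (Inv : ℕ → Mem → Prop)
    (hstep : ∀ j M, Inv j M → 0 < M a → ∃ i, j = i + 1 ∧ Reaches P M s (Inv i)) (j : ℕ) :
    ∀ M, Inv j M → Reaches (.whilePos a P) M (j * (s + 1) + 1)
      (fun M' => M' a ≤ 0 ∧ ∃ i, Inv i M') := by
  -- The loop may stop before its budget of `j` rounds is used up. In the budget, each round pays
  -- for its test and `s` steps, and the final `+ 1` pays for the failing test.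
  have halts_now : ∀ j M, Inv j M → M a ≤ 0 → Reaches (.whilePos a P) M (j * (s + 1) + 1)
      (fun M' => M' a ≤ 0 ∧ ∃ i, Inv i M') := by
    intro j M hI h
    refine reaches_of_one ⟨M, _, Exec.whileFalse h, ⟨h, _, hI⟩, fun k hk hM => ?_⟩
    simp only [Program.width, max_le_iff] at hk
    have := hM a
    exact ⟨fun a => (hM a).trans (by omega), by omega⟩
  induction j with
  | zero =>
    intro M hI
    rcases lt_or_ge 0 (M a) with h | h
    · obtain ⟨i, hi, -⟩ := hstep _ _ hI h
      omega
    · exact halts_now _ _ hI h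
  | succ j ih =>
    intro M hI
    rcases lt_or_ge 0 (M a) with h | h
    · obtain ⟨i, hi, M₁, t₁, he₁, hI₁, hb₁⟩ := hstep _ _ hI h
      obtain rfl : j = i := by omega
      obtain ⟨M₂, t₂, he₂, hq, hb₂⟩ := ih M₁ hI₁
      refine ⟨M₂, _, Exec.whileTrue h he₁ he₂, hq, fun k hk hM => ?_⟩
      have hk' := hk
      simp only [Program.width, max_le_iff] at hk
      obtain ⟨h1, h2⟩ := hb₁ k hk.2 hM
      obtain ⟨h3, h4⟩ := hb₂ (k + s) (by omega) h1
      have h5 := hM a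
      have e : (j + 1) * (s + 1) + 1 = 1 + s + (j * (s + 1) + 1) := by ring
      rw [e]
      generalize j * (s + 1) + 1 = r at *
      refine ⟨fun a => (h3 a).trans (by omega), ?_⟩
      calc bits a + bits (M a) + t₁ + t₂ ≤ 6 * k + 6 * s * (k + s) + 6 * r * (k + s + r) := by omega
        _ ≤ 6 * (k + (1 + s + r)) + 6 * s * (k + (1 + s + r)) + 6 * r * (k + (1 + s + r)) := by
            refine Nat.add_le_add (Nat.add_le_add ?_ ?_) ?_ <;>
              exact Nat.mul_le_mul_left _ (by omega)
        _ = _ := by ring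
    · exact halts_now _ _ hI h

/-- Do nothing (and spoil the cell `-40`). -/
def Program.skip : Program := .const (-40) 0

/-- Consecutive execution of a list of programs. -/
def Program.block : List Program → Program
  | [] => .skip
  | P :: Ps => .seq P (block Ps)

variable {L : List Program}

theorem reaches_block_nil (h : Q (Function.update M (-40) 0)) :
    Reaches (.block []) M (s + 1) Q :=
  reaches_const h

theorem reaches_block_cons (h : Reaches P M s fun M' => Reaches (.block L) M' t Q) :
    Reaches (.block (P :: L)) M (s + t) Q :=
  reaches_seq h

theorem reaches_block_const (h : Reaches (.block L) (Function.update M d k) s Q) :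
    Reaches (.block (.const d k :: L)) M (s + 1) Q := by
  rw [add_comm]; exact reaches_seq (reaches_const (s := 0) h)

theorem reaches_block_add (v : ℤ) (hv : M a + M b = v)
    (h : Reaches (.block L) (Function.update M d v) s Q) :
    Reaches (.block (.add d a b :: L)) M (s + 1) Q := by
  rw [add_comm]; exact reaches_seq (reaches_add (s := 0) v hv h)

theorem reaches_block_sub (v : ℤ) (hv : M a - M b = v)
    (h : Reaches (.block L) (Function.update M d v) s Q) :
    Reaches (.block (.sub d a b :: L)) M (s + 1) Q := by
  rw [add_comm]; exact reaches_seq (reaches_sub (s := 0) v hv h)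

theorem reaches_block_load (v : ℤ) (hv : M (M a) = v)
    (h : Reaches (.block L) (Function.update M d v) s Q) :
    Reaches (.block (.load d a :: L)) M (s + 1) Q := by
  rw [add_comm]; exact reaches_seq (reaches_load (s := 0) v hv h)

theorem reaches_block_store (v : ℤ) (hd : M a = d) (hv : M b = v)
    (h : Reaches (.block L) (Function.update M d v) s Q) :
    Reaches (.block (.store a b :: L)) M (s + 1) Q := by
  rw [add_comm]; exact reaches_seq (reaches_store (s := 0) v hd hv h)

/-! ### The input -/

theorem bits_initMem_le (xs : List ℤ) (a : ℤ) : bits (initMem xs a) ≤ inputSize xs + 1 := by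
  have h0 : bits 0 ≤ inputSize xs + 1 := by simp [bits]
  unfold initMem
  split_ifs
  · rcases lt_or_ge a.toNat xs.length with h | h
    · rw [List.getD_eq_getElem _ _ h]
      exact (List.single_le_sum (by simp) _ (List.mem_map_of_mem (List.getElem_mem h))).trans
        (Nat.le_succ _)
    · rw [List.getD_eq_default _ _ h]; exact h0
  · exact h0

theorem length_le_inputSize (xs : List ℤ) : xs.length ≤ inputSize xs := by
  induction xs with
  | nil => simp
  | cons x xs ih =>
    have := one_le_bits x
    simp only [inputSize, List.map_cons, List.sum_cons, List.length_cons] at *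
    omega

end RAM

/-! ### The program

Negative cells serve as registers. The cells from `-20` to `-1` hold the global variables:

* `-1`: the number `n` of vertices; `-2`: the capacity; `-3`: the constant `1`;
  `-10`: the constant `0`;
* `-4`, `-5`, `-6`, `-7`: the addresses of the left endpoints, the right endpoints, the weights and
  the blocks; the blocks are stored behind the input;
* `-11`: the number of vertices that have not been placed; `-12`: the index of the last block;
  `-13`: its weight; `-14`: the number of colors; `-15`: the counter of an outer loop.

The cells below `-20` are scratch space.
-/

set_option linter.unusedSimpArgs false

namespace RAM

namespace Program

/-- Set up the registers. -/
def setup : Program := block [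
  .add (-1) 0 (-10), .add (-2) 1 (-10), .const (-3) 1, .const (-4) 2, .add (-5) (-4) (-1),
  .add (-6) (-5) (-1), .add (-7) (-6) (-1), .add (-11) (-1) (-10), .add (-13) (-2) (-3)]

/-- Compare the vertex in `-21` with the best vertex so far, whose index plus one is in `-22` and
whose left endpoint is in `-23`. -/
def selectBody : Program := block [
  .sub (-21) (-21) (-3), .add (-24) (-7) (-21), .load (-24) (-24),
  .ifPos (-24) .skip (block [
    .add (-25) (-4) (-21), .load (-25) (-25), .const (-26) 1,
    .ifPos (-22) (.sub (-26) (-23) (-25)) .skip,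
    .ifPos (-26) (block [.add (-22) (-21) (-3), .add (-23) (-25) (-10)]) .skip])]

/-- Find a vertex with the least left endpoint among those that have not been placed. -/
def select : Program := block [
  .add (-21) (-1) (-10), .const (-22) 0, .whilePos (-21) selectBody]

/-- Place the selected vertex into the last block or into a new one. -/
def place : Program := block [
  .sub (-22) (-22) (-3), .add (-24) (-6) (-22), .load (-24) (-24), .add (-13) (-13) (-24),
  .sub (-25) (-13) (-2),
  .ifPos (-25) (block [.add (-12) (-12) (-3), .add (-13) (-24) (-10)]) .skip,
  .add (-26) (-7) (-22), .store (-26) (-12), .sub (-11) (-11) (-3)]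

/-- Place all vertices. -/
def placeAll : Program := .whilePos (-11) (block [select, place])

/-- Raise the number of colors if the intervals of the vertices in `-15` and `-21` require it. -/
def spanBody : Program := block [
  .sub (-21) (-21) (-3), .add (-24) (-5) (-15), .load (-24) (-24), .add (-25) (-4) (-21),
  .load (-25) (-25), .sub (-24) (-25) (-24),
  .ifPos (-24) .skip (block [
    .add (-26) (-7) (-21), .load (-26) (-26), .add (-26) (-26) (-3), .add (-27) (-7) (-15),
    .load (-27) (-27), .sub (-26) (-26) (-27), .sub (-28) (-26) (-14),
    .ifPos (-28) (.add (-14) (-26) (-10)) .skip])]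

/-- Compute the number of colors. -/
def span : Program := block [
  .add (-15) (-1) (-10),
  .whilePos (-15) (block [
    .sub (-15) (-15) (-3), .add (-21) (-1) (-10), .whilePos (-21) spanBody])]

/-- Write down the color of one vertex. -/
def paintBody : Program := block [
  .sub (-15) (-15) (-3), .add (-21) (-7) (-15), .load (-21) (-21), .sub (-22) (-21) (-14),
  .whilePos (-22) (block [.add (-21) (-22) (-10), .sub (-22) (-21) (-14)]),
  .add (-23) (-15) (-3), .store (-23) (-21)]

/-- Write down the colors. -/
def paint : Program := block [
  .add (-15) (-1) (-10), .whilePos (-15) paintBody, .add 0 (-14) (-10)]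

/-- The approximation algorithm. -/
def componentColoring : Program := block [setup, placeAll, span, paint]

end Program

open Program

/-! ### Registers and memory layout. -/

/-- The registers that stay constant. -/
structure Regs (n C : ℕ) (M : Mem) : Prop where
  size : M (-1) = n
  cap : M (-2) = C
  one : M (-3) = 1
  left : M (-4) = 2
  right : M (-5) = 2 + n
  weight : M (-6) = 2 + n + n
  block : M (-7) = 2 + n + n + n
  zero : M (-10) = 0

/-- The array at address `d` has the contents `x`. -/
def Holds {n : ℕ} (M : Mem) (d : ℤ) (x : Fin n → ℤ) : Prop := ∀ v : Fin n, M (d + v) = x v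

variable {n C : ℕ} {M M' : Mem} {d : ℤ} {l r : Fin n → ℤ} {w b : Fin n → ℕ}

theorem Regs.congr (h : Regs n C M) (hM : ∀ a, -10 ≤ a → a < 0 → M' a = M a) : Regs n C M' := by
  constructor <;> rw [hM _ (by omega) (by omega)]
  exacts [h.size, h.cap, h.one, h.left, h.right, h.weight, h.block, h.zero]

theorem Holds.congr {x : Fin n → ℤ} (h : Holds M d x) (hM : ∀ v : Fin n, M' (d + v) = M (d + v)) :
    Holds M' d x :=
  fun v => (hM v).trans (h v)

/-- The contents of the memory while the blocks are used. -/
structure Layout (l r : Fin n → ℤ) (w : Fin n → ℕ) (C : ℕ) (b : Fin n → ℕ) (M : Mem) : Prop where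
  regs : Regs n C M
  left : Holds M 2 l
  right : Holds M (2 + n) r
  weight : Holds M (2 + n + n) (fun v => w v)
  block : Holds M (2 + n + n + n) (fun v => b v)

/-- The working registers and the scratch space lie below `-10`, so changes there do not affect the
layout. -/
theorem Layout.congr (h : Layout l r w C b M) (hM : ∀ a, -10 ≤ a → M' a = M a) :
    Layout l r w C b M' where
  regs := h.regs.congr fun a ha _ => hM a ha
  left := h.left.congr fun v => hM _ (by omega)
  right := h.right.congr fun v => hM _ (by omega)
  weight := h.weight.congr fun v => hM _ (by omega)
  block := h.block.congr fun v => hM _ (by omega)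

/-! ### Selecting an unplaced vertex with the least left endpoint. -/

/-- The invariant of `select`: the vertices from `k` on have been considered. -/
def SelectInv (l : Fin n → ℤ) (b : Fin n → ℕ) (M₀ : Mem) (k : ℕ) (M : Mem) : Prop :=
  (∀ a, -20 ≤ a → M a = M₀ a) ∧ M (-21) = k ∧ k ≤ n ∧
    ((M (-22) = 0 ∧ ∀ v : Fin n, k ≤ v → 0 < b v) ∨
      ∃ x : Fin n, M (-22) = x + 1 ∧ M (-23) = l x ∧ b x = 0 ∧
        ∀ v : Fin n, k ≤ v → b v = 0 → l x ≤ l v)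

theorem reaches_selectBody {M₀ : Mem} (h₀ : Layout l r w C b M₀) {k : ℕ}
    (hI : SelectInv l b M₀ (k + 1) M) : Reaches selectBody M 15 (SelectInv l b M₀ k) := by
  obtain ⟨hfr, hk, hkn, hbest⟩ := hI
  have hM := h₀.congr fun a ha => hfr a (by omega)
  obtain ⟨-, -, h1, hL, -, -, hB, hz⟩ := hM.regs
  have hb := hM.block ⟨k, hkn⟩
  have hl := hM.left ⟨k, hkn⟩
  push_cast at hk
  simp only at hb hl
  refine reaches_block_sub k (by
      simp (disch := omega) only [Function.update_self, Function.update_of_ne, hk, h1, hB, hL,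
        add_sub_cancel_right, hb, hl]) ?_
  refine reaches_block_add (2 + n + n + n + k) (by
      simp (disch := omega) only [Function.update_self, Function.update_of_ne, hk, h1, hB, hL,
        add_sub_cancel_right, hb, hl]) ?_
  refine reaches_block_load (b ⟨k, hkn⟩) (by
      simp (disch := omega) only [Function.update_self, Function.update_of_ne, hk, h1, hB, hL,
        add_sub_cancel_right, hb, hl]) ?_
  refine reaches_block_cons (s := 11) (t := 1) ?_
  refine reaches_ifPos (s := 10) ?_ ?_
  · intro hpos
    simp (disch := omega) only [Function.update_self, Function.update_of_ne, hk, h1, hB,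
      add_sub_cancel_right, hb] at hpos
    refine reaches_const (reaches_block_nil ⟨?_, ?_, by omega, ?_⟩)
    · intro a ha
      simp (disch := omega) only [Function.update_of_ne, hfr]
    · simp (disch := omega) only [Function.update_self, Function.update_of_ne, hk, h1,
        add_sub_cancel_right]
    · simp (disch := omega) only [Function.update_self, Function.update_of_ne]
      have new : ∀ v : Fin n, k ≤ v → k + 1 ≤ v.1 ∨ 0 < b v := by
        intro v hv
        rcases hv.lt_or_eq with h | h
        · exact Or.inl h
        · right; subst h; exact_mod_cast hpos
      rcases hbest with ⟨h22, hall⟩ | ⟨x, h22, h23, hx, hall⟩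
      · exact Or.inl ⟨h22, fun v hv => (new v hv).elim (hall v) id⟩
      · exact Or.inr ⟨x, h22, h23, hx, fun v hv hv0 =>
          (new v hv).elim (fun h => hall v h hv0) (fun h => by omega)⟩
  · intro hpos
    simp (disch := omega) only [Function.update_self, Function.update_of_ne, hk, h1, hB,
      add_sub_cancel_right, hb] at hpos
    have hb0 : b ⟨k, hkn⟩ = 0 := by omega
    refine reaches_block_add (2 + k) (by
        simp (disch := omega) only [Function.update_self, Function.update_of_ne, hk, h1, hB, hL,
          add_sub_cancel_right, hb, hl]) ?_
    refine reaches_block_load (l ⟨k, hkn⟩) (by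
        simp (disch := omega) only [Function.update_self, Function.update_of_ne, hk, h1, hB, hL,
          add_sub_cancel_right, hb, hl]) ?_
    refine reaches_block_const (reaches_block_cons (s := 2) (t := 5) ?_)
    -- The two branches meet in one assertion: cell `-26` is positive iff there is no candidate yet
    -- (`-22` holds `0`) or the current vertex is strictly better than the candidate.
    refine Reaches.mono (Q := fun M₁ => (∀ a, -20 ≤ a → M₁ a = M₀ a) ∧ M₁ (-21) = k ∧
      M₁ (-22) = M (-22) ∧ M₁ (-23) = M (-23) ∧ M₁ (-25) = l ⟨k, hkn⟩ ∧
      (0 < M₁ (-26) ↔ (0 < M (-22) → l ⟨k, hkn⟩ < M (-23)))) ?_ le_rfl ?_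
    · refine reaches_ifPos (s := 1) ?_ ?_ <;> intro h22 <;>
        simp (disch := omega) only [Function.update_of_ne] at h22
      · refine reaches_sub (M (-23) - l ⟨k, hkn⟩) (by
          simp (disch := omega) only [Function.update_self, Function.update_of_ne])
          ⟨?_, ?_, ?_, ?_, ?_, ?_⟩
        · intro a ha
          simp (disch := omega) only [Function.update_of_ne, hfr]
        all_goals
          simp (disch := omega) only [Function.update_self, Function.update_of_ne, hk, h1, hL,
            add_sub_cancel_right, hl]
        simp [h22]
      · refine reaches_const ⟨?_, ?_, ?_, ?_, ?_, ?_⟩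
        · intro a ha
          simp (disch := omega) only [Function.update_of_ne, hfr]
        all_goals
          simp (disch := omega) only [Function.update_self, Function.update_of_ne, hk, h1, hL,
            add_sub_cancel_right, hl]
        simp [h22.not_gt]
    · rintro M₁ ⟨hfr₁, h21, h22, h23, h25, h26⟩
      have hz₁ : M₁ (-10) = 0 := by rw [hfr₁ _ (by omega), ← hfr _ (by omega), hz]
      have h1₁ : M₁ (-3) = 1 := by rw [hfr₁ _ (by omega), ← hfr _ (by omega), h1]
      refine reaches_block_cons (s := 4) (t := 1) (reaches_ifPos (s := 3) ?_ ?_)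
      all_goals intro hc
      · refine reaches_block_add (k + 1) (by
            simp (disch := omega) only [Function.update_self, Function.update_of_ne, h21, h1₁]) ?_
        refine reaches_block_add (l ⟨k, hkn⟩) (by
            simp (disch := omega) only [Function.update_self, Function.update_of_ne, h25, hz₁,
              add_zero]) ?_
        refine reaches_block_nil (s := 0) (reaches_block_nil
          (reaches_block_nil (s := 0) ⟨?_, ?_, by omega, Or.inr ⟨⟨k, hkn⟩, ?_, ?_, hb0, ?_⟩⟩))
        · intro a ha
          simp (disch := omega) only [Function.update_of_ne, hfr₁]
        · simp (disch := omega) only [Function.update_of_ne, h21]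
        · simp (disch := omega) only [Function.update_self, Function.update_of_ne, h21, h1₁]
        · simp (disch := omega) only [Function.update_self, Function.update_of_ne, h25, hz₁,
            add_zero]
        · intro v hv hv0
          rw [h26] at hc
          rcases hv.lt_or_eq with hv | hv
          · rcases hbest with ⟨-, hall⟩ | ⟨x, h22', h23', hx, hall⟩
            · have := hall v hv
              omega
            · have := hall v hv hv0
              have := hc (by omega)
              omega
          · obtain rfl : v = ⟨k, hkn⟩ := Fin.ext hv.symm
            exact le_rfl
      · refine reaches_const (reaches_block_nil (reaches_block_nil (s := 0)
          ⟨?_, ?_, by omega, Or.inr ?_⟩))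
        · intro a ha
          simp (disch := omega) only [Function.update_of_ne, hfr₁]
        · simp (disch := omega) only [Function.update_of_ne, h21]
        · have hc' := mt h26.2 hc.not_gt
          push Not at hc'
          rcases hbest with ⟨h22', hall⟩ | ⟨x, h22', h23', hx, hall⟩
          · omega
          · refine ⟨x, ?_, ?_, hx, ?_⟩
            · simp (disch := omega) only [Function.update_of_ne, h22, h22']
            · simp (disch := omega) only [Function.update_of_ne, h23, h23']
            · intro v hv hv0
              rcases hv.lt_or_eq with hv | hv
              · exact hall v hv hv0
              · obtain rfl : v = ⟨k, hkn⟩ := Fin.ext hv.symm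
                omega

theorem reaches_select (hM : Layout l r w C b M) (hb : ∃ v, b v = 0) :
    Reaches select M (16 * n + 4) fun M' => (∀ a, -20 ≤ a → M' a = M a) ∧
      ∃ x : Fin n, M' (-22) = x + 1 ∧ b x = 0 ∧ ∀ v, b v = 0 → l x ≤ l v := by
  have hs : 16 * n + 4 = (n * (15 + 1) + 1) + 1 + 1 + 1 := by ring
  rw [hs]
  refine reaches_block_add n (by rw [hM.regs.size, hM.regs.zero, add_zero])
    (reaches_block_const (reaches_block_cons (s := n * (15 + 1) + 1) (t := 1) (Reaches.mono
      (reaches_whilePos (SelectInv l b M) ?_ n _ ?_) le_rfl ?_)))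
  · intro j M' hI hpos
    have h21 := hI.2.1
    obtain ⟨k, rfl⟩ : ∃ k, j = k + 1 := ⟨j - 1, by omega⟩
    exact ⟨k, rfl, reaches_selectBody hM hI⟩
  · refine ⟨?_, ?_, le_rfl, Or.inl ⟨?_, fun v hv => ?_⟩⟩
    · intro a ha
      simp (disch := omega) only [Function.update_of_ne]
    · simp (disch := omega) only [Function.update_self, Function.update_of_ne, hM.regs.size,
        hM.regs.zero, add_zero]
    · exact Function.update_self ..
    · omega
  · rintro M' ⟨hle, k, hfr, h21, -, h⟩
    obtain rfl : k = 0 := by omega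
    refine reaches_block_nil (s := 0) ⟨?_, ?_⟩
    · intro a ha
      simp (disch := omega) only [Function.update_of_ne, hfr]
    · rcases h with ⟨-, hall⟩ | ⟨x, h22, -, hx, hall⟩
      · obtain ⟨v, hv⟩ := hb
        have := hall v (Nat.zero_le _)
        omega
      · refine ⟨x, ?_, hx, fun v => hall v (Nat.zero_le _)⟩
        simp (disch := omega) only [Function.update_of_ne, h22]

/-! ### Next fit on the machine. -/

/-- The invariant of `placeAll`: there are `k` vertices that have not been placed. -/
def PlaceInv (l r : Fin n → ℤ) (w : Fin n → ℕ) (C k : ℕ) (M : Mem) : Prop :=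
  ∃ (b : Fin n → ℕ) (blk sum : ℕ), Layout l r w C b M ∧ IsNextFit l w C b blk sum ∧
    M (-12) = blk ∧ M (-13) = sum ∧ M (-11) = k ∧ (Finset.univ.filter (b · = 0)).card = k ∧
    blk + k ≤ n ∧ M (-14) = 0

theorem card_unplaced_update {x : Fin n} (hx : b x = 0) {i : ℕ} (hi : 0 < i) :
    (Finset.univ.filter (Function.update b x i · = 0)).card =
      (Finset.univ.filter (b · = 0)).card - 1 := by
  rw [← Finset.card_erase_of_mem (a := x) (by simp [hx])]
  congr 1
  ext v
  by_cases hv : v = x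
  · subst hv; simp [hi.ne']
  · simp [hv]

/-- A round opens at most one block and places exactly one vertex, so `blk + k ≤ n` persists. In the
end this gives `blk ≤ n`, which bounds the time of the repeated subtractions when colors are
computed. -/
theorem reaches_place {blk sum k : ℕ} {x : Fin n} (hM : Layout l r w C b M)
    (hfit : IsNextFit l w C b blk sum) (h12 : M (-12) = blk) (h13 : M (-13) = sum)
    (h11 : M (-11) = (k + 1 : ℕ)) (hk : (Finset.univ.filter (b · = 0)).card = k + 1)
    (hn : blk + (k + 1) ≤ n) (h14 : M (-14) = 0) (h22 : M (-22) = x + 1) (hx : b x = 0)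
    (hmin : ∀ v, b v = 0 → l x ≤ l v) (hw : w x ≤ C) :
    Reaches place M 20 (PlaceInv l r w C k) := by
  obtain ⟨-, hC, h1, -, -, hW, hB, hz⟩ := hM.regs
  have hwx := hM.weight x
  simp only at hwx
  refine reaches_block_sub x (by
      simp (disch := omega) only [Function.update_self, Function.update_of_ne, hC, h1, hW, hwx,
        h13, h22, add_sub_cancel_right]) ?_
  refine reaches_block_add (2 + n + n + x) (by
      simp (disch := omega) only [Function.update_self, Function.update_of_ne, hC, h1, hW, hwx,
        h13, h22, add_sub_cancel_right]) ?_
  refine reaches_block_load (w x) (by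
      simp (disch := omega) only [Function.update_self, Function.update_of_ne, hC, h1, hW, hwx,
        h13, h22, add_sub_cancel_right]) ?_
  refine reaches_block_add (sum + w x) (by
      simp (disch := omega) only [Function.update_self, Function.update_of_ne, hC, h1, hW, hwx,
        h13, h22, add_sub_cancel_right]) ?_
  refine reaches_block_sub (sum + w x - C) (by
      simp (disch := omega) only [Function.update_self, Function.update_of_ne, hC, h1, hW, hwx,
        h13, h22, add_sub_cancel_right]) ?_
  refine reaches_block_cons (s := 5) (t := 10) ?_
  -- Both branches are summarized by the block `i` that receives `x` and its new weight `s`; the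
  -- block array itself is written only afterwards.
  refine Reaches.mono (Q := fun M₁ => (∀ a, -20 ≤ a → a ≠ -12 → a ≠ -13 → M₁ a = M a) ∧
    M₁ (-22) = x ∧ ∃ i s : ℕ, M₁ (-12) = i ∧ M₁ (-13) = s ∧ 0 < i ∧ i ≤ blk + 1 ∧
      IsNextFit l w C (Function.update b x i) i s) ?_ le_rfl ?_
  · refine reaches_ifPos (s := 4) ?_ ?_ <;> intro hc <;>
      simp (disch := omega) only [Function.update_self, Function.update_of_ne, hC, h1, hW, hwx,
        h13, h22, add_sub_cancel_right] at hc
    · refine reaches_block_add (blk + 1) (by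
        simp (disch := omega) only [Function.update_self, Function.update_of_ne, h12, h1]) ?_
      refine reaches_block_add (w x) (by
        simp (disch := omega) only [Function.update_self, Function.update_of_ne, hz, add_zero]) ?_
      refine reaches_block_nil
        ⟨?_, ?_, blk + 1, w x, ?_, ?_, by omega, le_rfl, hfit.open_new hx hmin (by omega) hw⟩
      · intro a ha h1 h2
        simp (disch := omega) only [Function.update_of_ne]
      all_goals
        simp (disch := omega) only [Function.update_self, Function.update_of_ne, hC, h1, hW, hwx,
          h12, h22, hz, add_sub_cancel_right, add_zero, Nat.cast_add, Nat.cast_one]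
    · have hblk : 0 < blk := by
        by_contra h0
        have := hfit.lt_sum (by omega)
        omega
      refine reaches_const ⟨?_, ?_, blk, sum + w x, ?_, ?_, hblk, by omega,
          hfit.add_to_last hx hmin (by omega)⟩
      · intro a ha h1 h2
        simp (disch := omega) only [Function.update_of_ne]
      all_goals
        simp (disch := omega) only [Function.update_self, Function.update_of_ne, hC, h1, hW, hwx,
          h12, h13, h22, hz, add_sub_cancel_right, add_zero, Nat.cast_add]
  · rintro M₁ ⟨hfr, h22₁, i, s, h12₁, h13₁, hi, hiblk, hfit₁⟩
    have hM₁ : Regs n C M₁ := hM.regs.congr fun a ha _ =>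
      hfr a (by omega) (by omega) (by omega)
    refine reaches_block_add (2 + n + n + n + x) (by
        simp (disch := omega) only [Function.update_self, Function.update_of_ne, hM₁.block,
          hM₁.one, h22₁, h12₁, hfr, h11, Nat.cast_add, Nat.cast_one, add_sub_cancel_right]) ?_
    refine reaches_block_store (d := 2 + n + n + n + x) i (by
        simp (disch := omega) only [Function.update_self, Function.update_of_ne, hM₁.block,
          hM₁.one, h22₁, h12₁, hfr, h11, Nat.cast_add, Nat.cast_one, add_sub_cancel_right]) (by
        simp (disch := omega) only [Function.update_self, Function.update_of_ne, hM₁.block,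
          hM₁.one, h22₁, h12₁, hfr, h11, Nat.cast_add, Nat.cast_one, add_sub_cancel_right]) ?_
    refine reaches_block_sub k (by
        simp (disch := omega) only [Function.update_self, Function.update_of_ne, hM₁.block,
          hM₁.one, h22₁, h12₁, hfr, h11, Nat.cast_add, Nat.cast_one, add_sub_cancel_right]) ?_
    refine reaches_block_nil
      ⟨Function.update b x i, i, s, ⟨?_, ?_, ?_, ?_, ?_⟩, hfit₁, ?_, ?_, ?_, ?_, ?_, ?_⟩
    · refine hM.regs.congr fun a ha ha' => ?_
      simp (disch := omega) only [Function.update_self, Function.update_of_ne, hM₁.block, h22₁,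
        hfr]
    · refine hM.left.congr fun v => ?_
      simp (disch := omega) only [Function.update_self, Function.update_of_ne, hM₁.block, h22₁,
        hfr]
    · refine hM.right.congr fun v => ?_
      simp (disch := omega) only [Function.update_self, Function.update_of_ne, hM₁.block, h22₁,
        hfr]
    · refine hM.weight.congr fun v => ?_
      simp (disch := omega) only [Function.update_self, Function.update_of_ne, hM₁.block, h22₁,
        hfr]
    · intro v
      by_cases hv : v = x
      · subst hv
        simp (disch := omega) only [Function.update_self, Function.update_of_ne, hM₁.block, h22₁,
          h12₁]
      · have hv' : (v : ℕ) ≠ x := fun h => hv (Fin.ext h)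
        have := hM.block v
        simp (disch := omega) only [Function.update_self, Function.update_of_ne, hM₁.block, h22₁,
          hfr, this]
    · simp (disch := omega) only [Function.update_self, Function.update_of_ne, hM₁.block, h22₁,
        h12₁]
    · simp (disch := omega) only [Function.update_self, Function.update_of_ne, hM₁.block, h22₁,
        h13₁]
    · simp (disch := omega) only [Function.update_self, Function.update_of_ne, hM₁.block, h22₁,
        hfr, h11, hM₁.one]
    · rw [card_unplaced_update hx hi, hk, Nat.add_sub_cancel]
    · omega
    · simp (disch := omega) only [Function.update_self, Function.update_of_ne, hM₁.block, h22₁,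
        hfr, h14]

theorem reaches_placeAll (hw : ∀ v, w v ≤ C) (hI : PlaceInv l r w C n M) :
    Reaches placeAll M (n * (16 * n + 26) + 1) (PlaceInv l r w C 0) := by
  refine Reaches.mono (reaches_whilePos (s := 16 * n + 25) (PlaceInv l r w C) ?_ n M hI) le_rfl ?_
  · rintro j M ⟨b, blk, sum, hM, hfit, h12, h13, h11, hk, hn, h14⟩ hpos
    obtain ⟨k, rfl⟩ : ∃ k, j = k + 1 := ⟨j - 1, by omega⟩
    refine ⟨k, rfl, ?_⟩
    have hs : 16 * n + 25 = (16 * n + 4) + (20 + 1) := by ring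
    rw [hs]
    obtain ⟨v, hv⟩ : (Finset.univ.filter (b · = 0)).Nonempty := by
      rw [← Finset.card_pos]
      omega
    refine reaches_block_cons ((reaches_select hM ⟨v, (Finset.mem_filter.1 hv).2⟩).mono le_rfl ?_)
    rintro M₁ ⟨hfr, x, h22, hx, hmin⟩
    refine reaches_block_cons ((reaches_place (hM.congr fun a ha => hfr a (by omega)) hfit
      (by rw [hfr _ (by omega), h12]) (by rw [hfr _ (by omega), h13])
      (by rw [hfr _ (by omega), h11]) hk hn (by rw [hfr _ (by omega), h14]) h22 hx hmin
      (hw x)).mono le_rfl ?_)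
    rintro M₂ ⟨b, blk, sum, hM, hfit, h12, h13, h11, hk, hn, h14⟩
    refine reaches_block_nil (s := 0)
      ⟨b, blk, sum, hM.congr fun a ha => ?_, hfit, ?_, ?_, ?_, hk, hn, ?_⟩ <;>
      simp (disch := omega) only [Function.update_of_ne, h12, h13, h11, h14]
  · rintro M' ⟨h, k, hI⟩
    have h11 : M' (-11) = k := by
      obtain ⟨b, blk, sum, hM, hfit, h12, h13, h11, hk, hn, h14⟩ := hI
      exact h11
    obtain rfl : k = 0 := by omega
    exact hI

/-! ### Computing the number of colors. -/

/-- The cyclic coloring of the blocks `b` with `lam` colors respects all pairs of meeting intervals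
in `S`, and if `lam` is positive, then some pair of meeting intervals does not allow fewer
colors. -/
def IsSpan (l r : Fin n → ℤ) (b : Fin n → ℕ) (S : Fin n → Fin n → Prop) (lam : ℕ) : Prop :=
  (∀ u v, S u v → l v ≤ r u → b v + 1 ≤ b u + lam) ∧
    (lam = 0 ∨ ∃ u v, l v ≤ r u ∧ b v + 1 = b u + lam)

/-- The invariant of `spanBody`: the vertices from `k` on have been compared with `u`. -/
def SpanInv (l r : Fin n → ℤ) (b : Fin n → ℕ) (u : ℕ) (M₀ : Mem) (k : ℕ) (M : Mem) : Prop :=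
  (∀ a, -20 ≤ a → a ≠ -14 → M a = M₀ a) ∧ M (-21) = k ∧ k ≤ n ∧
    ∃ lam : ℕ, M (-14) = lam ∧ IsSpan l r b (fun x y => u < x ∨ (x : ℕ) = u ∧ k ≤ y) lam

/-- One step of computing a maximum: either the pair of `u` and `k` is already respected by `lam`,
or `lam` is raised to exactly what this pair demands, which makes it the new tight pair. -/
theorem reaches_spanBody {M₀ : Mem} (h₀ : Layout l r w C b M₀) {u : Fin n} (hu : M₀ (-15) = u)
    {k : ℕ} (hI : SpanInv l r b u M₀ (k + 1) M) :
    Reaches spanBody M 20 (SpanInv l r b u M₀ k) := by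
  obtain ⟨hfr, hk, hkn, lam, h14, hlam, hlam'⟩ := hI
  obtain ⟨-, -, h1, hL, hR, -, hB, hz⟩ := h₀.regs
  have hbv := h₀.block ⟨k, hkn⟩
  have hlv := h₀.left ⟨k, hkn⟩
  have hbu := h₀.block u
  have hru := h₀.right u
  push_cast at hk
  simp only at hbv hlv hbu hru
  -- Lowering `k + 1` to `k` adds the single pair `(u, k)` to those already treated.
  have split : ∀ x y : Fin n, (u : ℕ) < x ∨ (x : ℕ) = u ∧ k ≤ y →
      ((u : ℕ) < x ∨ (x : ℕ) = u ∧ k + 1 ≤ y) ∨ x = u ∧ y = ⟨k, hkn⟩ := by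
    intro x y h
    simp only [Fin.ext_iff]
    omega
  refine reaches_block_sub k (by
      simp (disch := omega) only [Function.update_self, Function.update_of_ne, hfr, hk, h1, hL, hR,
        hB, hu, hlv, hru, hbu, hbv, h14, add_sub_cancel_right]) ?_
  refine reaches_block_add (2 + n + u) (by
      simp (disch := omega) only [Function.update_self, Function.update_of_ne, hfr, hk, h1, hL, hR,
        hB, hu, hlv, hru, hbu, hbv, h14, add_sub_cancel_right]) ?_
  refine reaches_block_load (r u) (by
      simp (disch := omega) only [Function.update_self, Function.update_of_ne, hfr, hk, h1, hL, hR,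
        hB, hu, hlv, hru, hbu, hbv, h14, add_sub_cancel_right]) ?_
  refine reaches_block_add (2 + k) (by
      simp (disch := omega) only [Function.update_self, Function.update_of_ne, hfr, hk, h1, hL, hR,
        hB, hu, hlv, hru, hbu, hbv, h14, add_sub_cancel_right]) ?_
  refine reaches_block_load (l ⟨k, hkn⟩) (by
      simp (disch := omega) only [Function.update_self, Function.update_of_ne, hfr, hk, h1, hL, hR,
        hB, hu, hlv, hru, hbu, hbv, h14, add_sub_cancel_right]) ?_
  refine reaches_block_sub (l ⟨k, hkn⟩ - r u) (by
      simp (disch := omega) only [Function.update_self, Function.update_of_ne, hfr, hk, h1, hL, hR,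
        hB, hu, hlv, hru, hbu, hbv, h14, add_sub_cancel_right]) ?_
  refine reaches_block_cons (s := 12) (t := 2) ?_
  refine reaches_ifPos (s := 11) ?_ ?_ <;> intro hc <;>
    simp (disch := omega) only [Function.update_self, Function.update_of_ne, hfr, hk, h1, hL, hR,
      hu, hlv, hru, add_sub_cancel_right] at hc
  · refine reaches_const (reaches_block_nil ⟨?_, ?_, by omega, lam, ?_, ?_, hlam'⟩)
    · intro a ha ha'
      simp (disch := omega) only [Function.update_of_ne, hfr]
    · simp (disch := omega) only [Function.update_self, Function.update_of_ne, hfr, hk, h1,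
        add_sub_cancel_right]
    · simp (disch := omega) only [Function.update_of_ne, h14]
    · intro x y hS hxy
      rcases split x y hS with h | ⟨rfl, rfl⟩
      · exact hlam x y h hxy
      · omega
  · refine reaches_block_add (2 + n + n + n + k) (by
        simp (disch := omega) only [Function.update_self, Function.update_of_ne, hfr, hk, h1, hL,
          hR, hB, hu, hlv, hru, hbu, hbv, h14, add_sub_cancel_right]) ?_
    refine reaches_block_load (b ⟨k, hkn⟩) (by
        simp (disch := omega) only [Function.update_self, Function.update_of_ne, hfr, hk, h1, hL,
          hR, hB, hu, hlv, hru, hbu, hbv, h14, add_sub_cancel_right]) ?_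
    refine reaches_block_add (b ⟨k, hkn⟩ + 1) (by
        simp (disch := omega) only [Function.update_self, Function.update_of_ne, hfr, hk, h1, hL,
          hR, hB, hu, hlv, hru, hbu, hbv, h14, add_sub_cancel_right]) ?_
    refine reaches_block_add (2 + n + n + n + u) (by
        simp (disch := omega) only [Function.update_self, Function.update_of_ne, hfr, hk, h1, hL,
          hR, hB, hu, hlv, hru, hbu, hbv, h14, add_sub_cancel_right]) ?_
    refine reaches_block_load (b u) (by
        simp (disch := omega) only [Function.update_self, Function.update_of_ne, hfr, hk, h1, hL,
          hR, hB, hu, hlv, hru, hbu, hbv, h14, add_sub_cancel_right]) ?_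
    refine reaches_block_sub (b ⟨k, hkn⟩ + 1 - b u) (by
        simp (disch := omega) only [Function.update_self, Function.update_of_ne, hfr, hk, h1, hL,
          hR, hB, hu, hlv, hru, hbu, hbv, h14, add_sub_cancel_right]) ?_
    refine reaches_block_sub (b ⟨k, hkn⟩ + 1 - b u - lam) (by
        simp (disch := omega) only [Function.update_self, Function.update_of_ne, hfr, hk, h1, hL,
          hR, hB, hu, hlv, hru, hbu, hbv, h14, add_sub_cancel_right]) ?_
    refine reaches_block_cons (s := 2) (t := 2) ?_
    refine reaches_ifPos (s := 1) ?_ ?_ <;> intro hc' <;>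
      simp (disch := omega) only [Function.update_self, Function.update_of_ne, hfr, hk, h1, hL, hR,
        hB, hu, hbv, hbu, h14, add_sub_cancel_right] at hc'
    · refine reaches_add (b ⟨k, hkn⟩ + 1 - b u) (by
        simp (disch := omega) only [Function.update_self, Function.update_of_ne, hfr, hz, add_zero])
        (reaches_block_nil (reaches_block_nil (s := 1)
        ⟨?_, ?_, by omega, b ⟨k, hkn⟩ + 1 - b u, ?_, ?_, Or.inr ⟨u, ⟨k, hkn⟩, by omega, ?_⟩⟩))
      · intro a ha ha'
        simp (disch := omega) only [Function.update_of_ne, hfr]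
      · simp (disch := omega) only [Function.update_self, Function.update_of_ne, hfr, hk, h1,
          add_sub_cancel_right]
      · simp (disch := omega) only [Function.update_self, Function.update_of_ne, hfr, hk, h1, hL,
          hR, hB, hu, hbv, hbu, h14, hz, add_sub_cancel_right, add_zero]
        omega
      · intro x y hS hxy
        rcases split x y hS with h | ⟨rfl, rfl⟩
        · have := hlam x y h hxy
          omega
        · omega
      · omega
    · refine reaches_const (reaches_block_nil (reaches_block_nil (s := 1)
        ⟨?_, ?_, by omega, lam, ?_, ?_, hlam'⟩))
      · intro a ha ha'
        simp (disch := omega) only [Function.update_of_ne, hfr]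
      · simp (disch := omega) only [Function.update_self, Function.update_of_ne, hfr, hk, h1,
          add_sub_cancel_right]
      · simp (disch := omega) only [Function.update_of_ne, h14]
      · intro x y hS hxy
        rcases split x y hS with h | ⟨rfl, rfl⟩
        · exact hlam x y h hxy
        · omega

theorem reaches_span (hM : Layout l r w C b M) (h14 : M (-14) = 0) :
    Reaches span M (n * (21 * n + 5) + 3) fun M' => Layout l r w C b M' ∧
      ∃ lam : ℕ, M' (-14) = lam ∧ IsSpan l r b (fun _ _ => True) lam := by
  let Inv : ℕ → Mem → Prop := fun k M => Layout l r w C b M ∧ M (-15) = k ∧ k ≤ n ∧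
    ∃ lam : ℕ, M (-14) = lam ∧ IsSpan l r b (fun x _ => k ≤ x) lam
  have hs : n * (21 * n + 5) + 3 = (n * (21 * n + 5) + 1 + 1) + 1 := by ring
  rw [hs]
  refine reaches_block_add n (by rw [hM.regs.size, hM.regs.zero, add_zero]) (reaches_block_cons
    (s := n * (21 * n + 5) + 1) (t := 1) (Reaches.mono (reaches_whilePos (s := 21 * n + 4) Inv ?_ n
      _ ?_) le_rfl ?_))
  · rintro j M ⟨hM, h15, hjn, lam, h14, hlam, hlam'⟩ hpos
    obtain ⟨k, rfl⟩ : ∃ k, j = k + 1 := ⟨j - 1, by omega⟩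
    refine ⟨k, rfl, ?_⟩
    have hs : 21 * n + 4 = (n * (20 + 1) + 1 + 1) + 1 + 1 := by ring
    rw [hs]
    refine reaches_block_sub k (by
        simp (disch := omega) only [Function.update_self, Function.update_of_ne, h15, hM.regs.one,
          Nat.cast_add, Nat.cast_one, add_sub_cancel_right]) ?_
    refine reaches_block_add n (by
        simp (disch := omega) only [Function.update_self, Function.update_of_ne, hM.regs.size,
          hM.regs.zero, add_zero]) ?_
    set M₁ := Function.update (Function.update M (-15) k) (-21) n with hM₁
    have hfr : ∀ a, -20 ≤ a → a ≠ -15 → M₁ a = M a := by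
      intro a ha ha'
      simp (disch := omega) only [hM₁, Function.update_of_ne]
    have hL₁ : Layout l r w C b M₁ := hM.congr fun a ha => hfr a (by omega) (by omega)
    have h15₁ : M₁ (-15) = (⟨k, hjn⟩ : Fin n) := by
      simp (disch := omega) only [hM₁, Function.update_self, Function.update_of_ne]
    have h21₁ : M₁ (-21) = n := by
      simp (disch := omega) only [hM₁, Function.update_self, Function.update_of_ne]
    clear_value M₁
    refine reaches_block_cons (s := n * (20 + 1) + 1) (t := 1)
      (Reaches.mono (reaches_whilePos (SpanInv l r b k M₁) ?_ n _ ?_) le_rfl ?_)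
    · intro j M₂ hI hpos
      have h21 := hI.2.1
      obtain ⟨i, rfl⟩ : ∃ i, j = i + 1 := ⟨j - 1, by omega⟩
      exact ⟨i, rfl, reaches_spanBody hL₁ h15₁ hI⟩
    · refine ⟨fun _ _ _ => rfl, h21₁, le_rfl, lam, ?_, ?_, hlam'⟩
      · rw [hfr _ (by omega) (by omega), h14]
      · intro x y hS hxy
        exact hlam x y (by omega) hxy
    · rintro M₂ ⟨hle, i, hfr₂, h21, -, lam, h14, hlam, hlam'⟩
      obtain rfl : i = 0 := by omega
      refine reaches_block_nil (s := 0) ⟨hL₁.congr fun a ha => ?_, ?_, by omega, lam, ?_, ?_, hlam'⟩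
      · simp (disch := omega) only [Function.update_of_ne, hfr₂]
      · simp (disch := omega) only [Function.update_of_ne, hfr₂, h15₁]
      · simp (disch := omega) only [Function.update_of_ne, h14]
      · intro x y hS hxy
        exact hlam x y (by omega) hxy
  · refine ⟨hM.congr fun a ha => ?_, ?_, le_rfl, 0, ?_, ?_, Or.inl rfl⟩
    · simp (disch := omega) only [Function.update_of_ne]
    · simp (disch := omega) only [Function.update_self, Function.update_of_ne, hM.regs.size,
        hM.regs.zero, add_zero]
    · simp (disch := omega) only [Function.update_of_ne, h14, Nat.cast_zero]
    · intro x y hS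
      omega
  · rintro M' ⟨hle, k, hM', h15, -, lam, h14, hlam, hlam'⟩
    obtain rfl : k = 0 := by omega
    refine reaches_block_nil (s := 0) ⟨hM'.congr fun a ha => ?_, lam, ?_, ?_, hlam'⟩
    · simp (disch := omega) only [Function.update_of_ne]
    · simp (disch := omega) only [Function.update_of_ne, h14]
    · intro x y _ hxy
      exact hlam x y (Nat.zero_le _) hxy

/-! ### Writing the colors. -/

/-- The invariant of `paintBody`: the vertices from `k` on have their colors. -/
def PaintInv (C : ℕ) (b : Fin n → ℕ) (lam k : ℕ) (M : Mem) : Prop :=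
  Regs n C M ∧ Holds M (2 + n + n + n) (fun v => b v) ∧ M (-14) = lam ∧ M (-15) = k ∧ k ≤ n ∧
    ∀ v : Fin n, k ≤ v → M (v + 1) = ((b v - 1) % lam + 1 : ℕ)

/-- The colors overwrite the capacity and part of the input arrays, which is why `PaintInv` retains
only the registers and the blocks. The cell `k + 1` is at most `n` and so lies before the block
array. -/
theorem reaches_paintBody {lam k : ℕ} (hlam : 0 < lam) (hpos : ∀ v, 0 < b v) (hbn : ∀ v, b v ≤ n)
    (hI : PaintInv C b lam (k + 1) M) :
    Reaches paintBody M (4 * n + 10) (PaintInv C b lam k) := by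
  obtain ⟨hM, hb, h14, h15, hkn, hcol⟩ := hI
  obtain ⟨v, hv⟩ : ∃ v : Fin n, (v : ℕ) = k := ⟨⟨k, hkn⟩, rfl⟩
  have hbv := hb v
  push_cast at h15
  simp only [hv] at hbv
  have hs : 4 * n + 10 = (n * (3 + 1) + 1 + 5) + 1 + 1 + 1 + 1 := by ring
  rw [hs]
  refine reaches_block_sub k (by
      simp (disch := omega) only [Function.update_self, Function.update_of_ne, h15, hM.one,
        add_sub_cancel_right, hM.block, hbv, h14]) ?_
  refine reaches_block_add (2 + n + n + n + k) (by
      simp (disch := omega) only [Function.update_self, Function.update_of_ne, h15, hM.one,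
        add_sub_cancel_right, hM.block, hbv, h14]) ?_
  refine reaches_block_load (b v) (by
      simp (disch := omega) only [Function.update_self, Function.update_of_ne, h15, hM.one,
        add_sub_cancel_right, hM.block, hbv, h14]) ?_
  refine reaches_block_sub (b v - lam) (by
      simp (disch := omega) only [Function.update_self, Function.update_of_ne, h15, hM.one,
        add_sub_cancel_right, hM.block, hbv, h14]) ?_
  set M₁ := Function.update (Function.update _ (-21) _) (-22) _ with hM₁
  have hfr : ∀ a, -20 ≤ a → a ≠ -15 → M₁ a = M a := by
    intro a ha ha'
    simp (disch := omega) only [hM₁, Function.update_of_ne]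
  have h15₁ : M₁ (-15) = k := by
    simp (disch := omega) only [hM₁, Function.update_self, Function.update_of_ne]
  have h21₁ : M₁ (-21) = b v := by
    simp (disch := omega) only [hM₁, Function.update_self, Function.update_of_ne]
  have h22₁ : M₁ (-22) = b v - lam := by
    simp (disch := omega) only [hM₁, Function.update_self, Function.update_of_ne]
  clear_value M₁
  -- Division with remainder by repeated subtraction of `lam`. The remainder `c` is kept positive,
  -- so that it ends in `1, …, lam`. Since `0 < lam`, the bound `j` on `c - lam` drops in every
  -- round.
  let Inv : ℕ → Mem → Prop := fun j M => (∀ a, -20 ≤ a → M a = M₁ a) ∧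
    ∃ c q : ℕ, M (-21) = c ∧ M (-22) = c - lam ∧ 0 < c ∧ b v = c + q * lam ∧ (c : ℤ) - lam ≤ j
  refine reaches_block_cons (s := n * (3 + 1) + 1) (t := 5)
    (Reaches.mono (reaches_whilePos (s := 3) Inv ?_ (b v) _ ?_) ?_ ?_)
  · rintro j M ⟨hfr', c, q, h21, h22, hc, hq, hj⟩ hpos
    obtain ⟨i, rfl⟩ : ∃ i, j = i + 1 := ⟨j - 1, by omega⟩
    have hz : M (-10) = 0 := by
      rw [hfr' _ (by omega), hfr _ (by omega) (by omega), hM.zero]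
    have h14' : M (-14) = lam := by
      rw [hfr' _ (by omega), hfr _ (by omega) (by omega), h14]
    refine ⟨i, rfl, ?_⟩
    refine reaches_block_add (c - lam) (by
        simp (disch := omega) only [Function.update_self, Function.update_of_ne, h22, hz,
          add_zero]) ?_
    refine reaches_block_sub (c - lam - lam) (by
        simp (disch := omega) only [Function.update_self, Function.update_of_ne, h14']) ?_
    refine reaches_block_nil ⟨?_, c - lam, q + 1, ?_, ?_, by omega, ?_, by omega⟩
    · intro a ha
      simp (disch := omega) only [Function.update_of_ne, hfr']
    · simp (disch := omega) only [Function.update_self, Function.update_of_ne, h22, hz]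
      omega
    · simp (disch := omega) only [Function.update_self, Function.update_of_ne, h22, hz, h14']
      omega
    · rw [add_mul, one_mul]
      omega
  · exact ⟨fun _ _ => rfl, b v, 0, h21₁, h22₁, hpos v, by simp, by omega⟩
  · have := Nat.mul_le_mul_right (3 + 1) (hbn v)
    omega
  · rintro M₂ ⟨hle, j, hfr₂, c, q, h21, h22, hc, hq, hj⟩
    -- On exit `0 < c ≤ lam`, so `c - 1` is the remainder of `b v - 1`.
    have hcol' : (b v - 1) % lam + 1 = c := by
      have : b v - 1 = (c - 1) + q * lam := by omega
      rw [this, Nat.add_mul_mod_self_right, Nat.mod_eq_of_lt (by omega)]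
      omega
    have h1 : M₂ (-3) = 1 := by
      rw [hfr₂ _ (by omega), hfr _ (by omega) (by omega), hM.one]
    have h15₂ : M₂ (-15) = k := by rw [hfr₂ _ (by omega), h15₁]
    refine reaches_block_add (k + 1) (by
        simp (disch := omega) only [Function.update_self, Function.update_of_ne, h15₂, h1, h21]) ?_
    refine reaches_block_store (d := k + 1) c (by
        simp (disch := omega) only [Function.update_self, Function.update_of_ne, h15₂, h1, h21]) (by
        simp (disch := omega) only [Function.update_self, Function.update_of_ne, h15₂, h1, h21]) ?_
    refine reaches_block_nil ⟨hM.congr ?_, hb.congr ?_, ?_, ?_, by omega, ?_⟩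
    · intro a ha ha'
      simp (disch := omega) only [Function.update_self, Function.update_of_ne, h15₂, h1, hfr₂, hfr]
    · intro v
      simp (disch := omega) only [Function.update_self, Function.update_of_ne, h15₂, h1, hfr₂, hfr]
    · simp (disch := omega) only [Function.update_self, Function.update_of_ne, h15₂, h1, hfr₂, hfr,
        h14]
    · simp (disch := omega) only [Function.update_self, Function.update_of_ne, h15₂, h1]
    · intro x hx
      by_cases hxv : x = v
      · rw [hxv, hcol', hv]
        simp (disch := omega) only [Function.update_self, Function.update_of_ne, h15₂, h1, h21]
      · have hxk : (x : ℕ) ≠ k := fun h => hxv (Fin.ext (h.trans hv.symm))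
        simp (disch := omega) only [Function.update_self, Function.update_of_ne, h15₂, h1, hfr₂,
          hfr]
        exact hcol x (by omega)

theorem reaches_paint {lam : ℕ} (hlam : 0 < n → 0 < lam) (hpos : ∀ v, 0 < b v)
    (hbn : ∀ v, b v ≤ n) (hM : Layout l r w C b M) (h14 : M (-14) = lam) :
    Reaches paint M (n * (4 * n + 11) + 4) fun M' =>
      M' 0 = lam ∧ ∀ v : Fin n, M' (v + 1) = ((b v - 1) % lam + 1 : ℕ) := by
  have hs : n * (4 * n + 11) + 4 = (n * (4 * n + 10 + 1) + 1 + 2) + 1 := by ring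
  rw [hs]
  refine reaches_block_add n (by rw [hM.regs.size, hM.regs.zero, add_zero]) (reaches_block_cons
    (s := n * (4 * n + 10 + 1) + 1) (t := 2) (Reaches.mono (reaches_whilePos (PaintInv C b lam) ?_
      n _ ?_) le_rfl ?_))
  · intro j M' hI h
    have h15 := hI.2.2.2.1
    have hjn := hI.2.2.2.2.1
    obtain ⟨k, rfl⟩ : ∃ k, j = k + 1 := ⟨j - 1, by omega⟩
    exact ⟨k, rfl, reaches_paintBody (hlam (by omega)) hpos hbn hI⟩
  · refine ⟨hM.regs.congr fun a ha _ => ?_, hM.block.congr fun v => ?_, ?_, ?_, le_rfl, ?_⟩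
    · simp (disch := omega) only [Function.update_of_ne]
    · simp (disch := omega) only [Function.update_of_ne]
    · simp (disch := omega) only [Function.update_of_ne, h14]
    · simp (disch := omega) only [Function.update_self, Function.update_of_ne, hM.regs.size,
        hM.regs.zero, add_zero]
    · intro v hv
      omega
  · rintro M' ⟨hle, k, hM', hb, h14', h15, -, hcol⟩
    obtain rfl : k = 0 := by omega
    refine reaches_block_add lam (by rw [h14', hM'.zero, add_zero])
      (reaches_block_nil (s := 0) ⟨?_, fun v => ?_⟩)
    · simp (disch := omega) only [Function.update_self, Function.update_of_ne, h14', hM'.zero,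
        add_zero]
    · simp (disch := omega) only [Function.update_of_ne]
      exact hcol v (Nat.zero_le _)

/-! ### The initial memory -/

theorem initMem_ofFn {xs ys : List ℤ} {d : ℤ} (hd : d = xs.length) (x : Fin n → ℤ) :
    Holds (initMem (xs ++ List.ofFn x ++ ys)) d x := by
  intro v
  have h : (d + v).toNat = xs.length + v := by omega
  rw [initMem, if_pos (by omega), h, List.append_assoc, List.getD_append_right _ _ _ _ (by omega),
    List.getD_append _ _ _ _ (by simp), Nat.add_sub_cancel_left,
    List.getD_eq_getElem _ _ (by simp)]
  simp

theorem initMem_eq_zero {xs : List ℤ} {a : ℤ} (ha : a < 0 ∨ xs.length ≤ a) :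
    initMem xs a = 0 := by
  unfold initMem
  split_ifs with h
  · exact List.getD_eq_default _ _ (by omega)
  · rfl

theorem length_encodeInstance (l r : Fin n → ℤ) (w : Fin n → ℕ) (C : ℕ) :
    (encodeInstance l r w C).length = 2 + n + n + n := by
  simp [encodeInstance]
  ring

/-- The block array lies behind the input, where the memory is `0`; this already encodes that no
vertex is placed. The registers `-10`, `-12` and `-14` also start as `0`, and `-13` receives `C +
1`, so that the first vertex opens a block. -/
theorem reaches_setup (l r : Fin n → ℤ) (w : Fin n → ℕ) (C : ℕ) :
    Reaches setup (initMem (encodeInstance l r w C)) 10 (PlaceInv l r w C n) := by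
  have hlen := length_encodeInstance l r w C
  have hzero : ∀ a : ℤ, a < 0 ∨ 2 + n + n + n ≤ a → initMem (encodeInstance l r w C) a = 0 :=
    fun a ha => initMem_eq_zero (by rw [hlen]; exact_mod_cast ha)
  have h0 : initMem (encodeInstance l r w C) 0 = n := rfl
  have h1 : initMem (encodeInstance l r w C) 1 = C := rfl
  have hl : Holds (initMem (encodeInstance l r w C)) 2 l := by
    have := initMem_ofFn (xs := [(n : ℤ), (C : ℤ)])
      (ys := List.ofFn r ++ List.ofFn fun v => (w v : ℤ)) (d := 2) (by simp) l
    simpa only [encodeInstance, List.append_assoc] using this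
  have hr : Holds (initMem (encodeInstance l r w C)) (2 + n) r := by
    have := initMem_ofFn (xs := [(n : ℤ), (C : ℤ)] ++ List.ofFn l)
      (ys := List.ofFn fun v => (w v : ℤ)) (d := 2 + n) (by simp; ring) r
    simpa only [encodeInstance, List.append_assoc] using this
  have hw : Holds (initMem (encodeInstance l r w C)) (2 + n + n) (fun v => w v) := by
    have := initMem_ofFn (xs := [(n : ℤ), (C : ℤ)] ++ List.ofFn l ++ List.ofFn r)
      (ys := []) (d := 2 + n + n) (by simp; ring) (fun v => (w v : ℤ))
    simpa only [encodeInstance, List.append_assoc, List.append_nil] using this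
  generalize initMem (encodeInstance l r w C) = M at *
  refine reaches_block_add n (by
      simp (disch := omega) only [Function.update_self, Function.update_of_ne, hzero, h0, h1,
        add_zero]) ?_
  refine reaches_block_add C (by
      simp (disch := omega) only [Function.update_self, Function.update_of_ne, hzero, h0, h1,
        add_zero]) ?_
  refine reaches_block_const (reaches_block_const ?_)
  refine reaches_block_add (2 + n) (by
      simp (disch := omega) only [Function.update_self, Function.update_of_ne, add_zero]) ?_
  refine reaches_block_add (2 + n + n) (by
      simp (disch := omega) only [Function.update_self, Function.update_of_ne, add_zero]) ?_
  refine reaches_block_add (2 + n + n + n) (by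
      simp (disch := omega) only [Function.update_self, Function.update_of_ne, add_zero]) ?_
  refine reaches_block_add n (by
      simp (disch := omega) only [Function.update_self, Function.update_of_ne, hzero, h0, h1,
        add_zero]) ?_
  refine reaches_block_add (C + 1) (by
      simp (disch := omega) only [Function.update_self, Function.update_of_ne, hzero, h0, h1,
        add_zero]) ?_
  refine reaches_block_nil ⟨fun _ => 0, 0, C + 1, ⟨?_, hl.congr fun v => ?_, hr.congr fun v => ?_,
    hw.congr fun v => ?_, fun v => ?_⟩, IsNextFit.init l w C, ?_, ?_, ?_, ?_, ?_, ?_⟩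
  · constructor <;>
      simp (disch := omega) only [Function.update_self, Function.update_of_ne, hzero, h0, h1,
        add_zero]
  all_goals
    try simp (disch := omega) only [Function.update_self, Function.update_of_ne, hzero, h0, h1,
      add_zero, Nat.cast_zero, Nat.cast_add, Nat.cast_one]
  · simp
  · omega

/-! ### The algorithm -/

theorem reaches_componentColoring (hlr : ∀ v, l v ≤ r v) (hw : ∀ v, w v ≤ C) :
    Reaches componentColoring (initMem (encodeInstance l r w C)) (50 * (n + 1) ^ 2) fun M =>
      ∃ (b : Fin n → ℕ) (blk sum lam : ℕ), IsNextFit l w C b blk sum ∧ (∀ v, 0 < b v) ∧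
        IsSpan l r b (fun _ _ => True) lam ∧ M 0 = lam ∧
        ∀ v : Fin n, M (v + 1) = ((b v - 1) % lam + 1 : ℕ) := by
  have hs : 10 + ((n * (16 * n + 26) + 1) + ((n * (21 * n + 5) + 3) +
      ((n * (4 * n + 11) + 4) + 1))) ≤ 50 * (n + 1) ^ 2 := by
    ring_nf
    omega
  refine Reaches.mono (reaches_block_cons ((reaches_setup l r w C).mono le_rfl fun M₁ h₁ =>
    reaches_block_cons ((reaches_placeAll hw h₁).mono le_rfl ?_))) hs fun _ h => h
  rintro M₂ ⟨b, blk, sum, hM₂, hfit, -, -, -, hcard, hn, h14⟩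
  have hpos : ∀ v, 0 < b v := by
    intro v
    rw [Finset.card_eq_zero, Finset.filter_eq_empty_iff] at hcard
    have := hcard (Finset.mem_univ v)
    omega
  refine reaches_block_cons ((reaches_span hM₂ h14).mono le_rfl ?_)
  rintro M₃ ⟨hM₃, lam, h14₃, hlam⟩
  -- Every interval meets itself, and the pair of a vertex with itself demands one color.
  have hlam0 : 0 < n → 0 < lam := by
    intro h
    have := hlam.1 ⟨0, h⟩ ⟨0, h⟩ trivial (hlr _)
    omega
  refine reaches_block_cons ((reaches_paint hlam0 hpos
    (fun v => (hfit.le_blk v).trans (by omega)) hM₃ h14₃).mono le_rfl ?_)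
  rintro M₄ ⟨h0, hcol⟩
  refine reaches_block_nil (s := 0) ⟨b, blk, sum, lam, hfit, hpos, hlam, ?_, fun v => ?_⟩
  · simp (disch := omega) only [Function.update_of_ne, h0]
  · simp (disch := omega) only [Function.update_of_ne, hcol]

theorem width_componentColoring : componentColoring.width ≤ 10 := by
  have h : ∀ z, bits z ≤ 10 ↔ z.natAbs < 2 ^ 9 := fun z => bits_le_iff
  simp only [componentColoring, setup, placeAll, select, selectBody, place, span, spanBody, paint,
    paintBody, block, skip, width, max_le_iff, h]
  norm_num

end RAM

/-- There is a polynomial-time 2-approximation algorithm for non-splittable weighted component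
coloring of proper interval graphs that are given with an interval representation. -/
theorem theorem3 :
    ∃ (P : RAM.Program) (p : Polynomial ℕ),
      ∀ (n : ℕ) (G : SimpleGraph (Fin n)) (l r : Fin n → ℤ) (w : Fin n → ℕ) (C : ℕ),
        IsProperIntervalRep G l r → (∀ v, w v ≤ C) →
        ∃ (M : RAM.Mem) (t : ℕ),
          RAM.Exec P (RAM.initMem (encodeInstance l r w C)) M t ∧
          t ≤ p.eval (RAM.inputSize (encodeInstance l r w C)) ∧
          ∃ (lam : ℕ) (f : Fin n → Fin lam),
            DisplaysAssignment M f ∧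
            IsComponentColoring G w C f ∧
            ∀ μ : ℕ, IsComponentColorable G w μ C → lam ≤ 2 * μ := by
  refine ⟨RAM.Program.componentColoring,
    -- This is `6 * s * (k + s)` with `s = 50 * (n + 1) ^ 2` steps and `n` replaced by the input
    -- size `N`. The value `k = N + 10` covers both the initial memory and the constants in the
    -- program text.
    6 * (50 * (Polynomial.X + 1) ^ 2) * ((Polynomial.X + 10) + 50 * (Polynomial.X + 1) ^ 2),
    fun n G l r w C hG hw => ?_⟩
  obtain ⟨M, t, hexec, ⟨b, blk, sum, lam, hfit, hpos, hlam, h0, hcol⟩, hbound⟩ :=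
    RAM.reaches_componentColoring hG.left_le_right hw
  refine ⟨M, t, hexec, ?_, lam, fun v => ⟨(b v - 1) % lam, Nat.mod_lt _ ?_⟩, ⟨h0, hcol⟩, ?_, ?_⟩
  · have hn : n ≤ RAM.inputSize (encodeInstance l r w C) := by
      have := RAM.length_le_inputSize (encodeInstance l r w C)
      rw [RAM.length_encodeInstance] at this
      omega
    set N := RAM.inputSize (encodeInstance l r w C) with hN
    have ht := (hbound (N + 10) (RAM.width_componentColoring.trans (by omega)) fun a =>
      (RAM.bits_initMem_le _ a).trans (by omega)).2
    refine ht.trans ?_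
    simp only [Polynomial.eval_mul, Polynomial.eval_add, Polynomial.eval_pow, Polynomial.eval_X,
      Polynomial.eval_one, Polynomial.eval_ofNat]
    gcongr
  · have := hlam.1 v v trivial (hG.left_le_right v)
    omega
  · refine hfit.isComponentColoring hpos (lam := lam) (fun u v huv => ?_) fun v => rfl
    exact hlam.1 u v trivial ((hG.adj_iff_le huv.ne).1 huv).2
  · intro μ hμ
    -- Some meeting pair is tight for `lam`, and the clique bound applies to that pair.
    rcases hlam.2 with rfl | ⟨u, v, huv, hlam'⟩
    · exact Nat.zero_le _
    · have := hfit.span_le hG hpos hμ huv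
      omega
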